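/- Conventions. Let $n\in\mathbb N$ and let $|G|$ denote Lebesgue measure on $\mathbb{R}^n$. For a nonempty open set $G\subset\mathbb{R}^n$ of finite measure, a rearrangement invariant Banach function norm over $G$ is a functional $\rho$ on the measurable functions $G\to[0,\infty]$, with values $\rho(f)\in[0,\infty]$, such that for all such $f,g,f_k$, all constants $a\ge 0$ and all measurable $E\subset G$: (i) $\rho(f)=0$ iff $f=0$ a.e., $\rho(af)=a\rho(f)$, $\rho(f+g)\le\rho(f)+\rho(g)$; (ii) $f\le g$ a.e. implies $\rho(f)\le\rho(g)$; (iii) $f_k\uparrow f$ a.e. implies $\rho(f_k)\uparrow\rho(f)$; (iv) $\rho(\chi_E)<\infty$; (v) $\int_E f\le C_E\,\rho(f)$ with $C_E<\infty$ independent of $f$; (vi) $\rho(f)=\rho(g)$ whenever $|\{f>\lambda\}|=|\{g>\lambda\}|$ for all $\lambda\ge 0$. Put $f^*(s)=\inf\{\lambda: |\{f>\lambda\}|\le s\}$. A rearrangement invariant Banach function space (r.i. BFS) $X$ is given by r.i. Banach function norms $\|\cdot\|_{X(G)}$ over all nonempty open sets $G\subset\mathbb{R}^n$ of finite measure which are pairwise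 similar: for all such $G,G'$, with $\eta=|G'|/|G|$, one has $\eta\|f\|_{X(G)}=\|g\|_{X(G')}$ whenever $f^*(x)=g^*(\eta x)$ for all $0<x<|G|$. A measurable vector valued function $u$ belongs to $X(G)$ if $\|\,|u|\,\|_{X(G)}<\infty$; $u\in W^1X(G)$ means that $u$ is weakly differentiable in $G$ with $u, Du\in X(G)$; and $u\in W^1X_{\mathrm{loc}}(\Omega)$ means that $u\in W^1X(G)$ for every nonempty open $G$ whose closure is a compact subset of $\Omega$. Theorem. Let $\Omega,\Omega'\subset\mathbb{R}^n$ be open and let $f:\Omega\to\Omega'$ be a bilipschitz homeomorphism, i.e. a homeomorphism of $\Omega$ onto $\Omega'$ such that for some $L>0$, $L^{-1}|x-y|\le|f(x)-f(y)|\le L|x-y|$ for all $x,y\in\Omega$. Let $X$ be an r.i. BFS (no assumption on its Boyd indices is made). If the weak derivative $Df$ belongs to $W^1X_{\mathrm{loc}}(\Omega,\mathbb{R}^{n^2})$, then $f^{-1}$ is weakly differentiable in $\Omega'$ and $Df^{-1}\in W^1X_{\mathrm{loc}}(\Omega',\mathbb{R}^{n^2})$. -/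

import Mathlib

open Set Filter Topology MeasureTheory
open scoped ENNReal NNReal

/-- The Euclidean space `ℝⁿ`. -/
abbrev RSpace (n : ℕ) : Type := EuclideanSpace ℝ (Fin n)

/-- A Banach function norm `ρ` over a measure space, defined on the nonnegative
(almost everywhere) measurable functions with values in `[0, ∞]`. The values of `ρ` at other
functions are irrelevant. -/
structure IsBanachFunctionNorm {α : Type*} [MeasurableSpace α] (μ : Measure α)
    (ρ : (α → ℝ≥0∞) → ℝ≥0∞) : Prop where
  eq_zero_iff : ∀ f : α → ℝ≥0∞, AEMeasurable f μ → (ρ f = 0 ↔ f =ᵐ[μ] 0)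
  smul : ∀ (a : ℝ≥0) (f : α → ℝ≥0∞), AEMeasurable f μ →
    ρ (fun x => (a : ℝ≥0∞) * f x) = (a : ℝ≥0∞) * ρ f
  add_le : ∀ f g : α → ℝ≥0∞, AEMeasurable f μ → AEMeasurable g μ →
    ρ (fun x => f x + g x) ≤ ρ f + ρ g
  mono : ∀ f g : α → ℝ≥0∞, AEMeasurable f μ → AEMeasurable g μ →
    f ≤ᵐ[μ] g → ρ f ≤ ρ g
  fatou : ∀ (f : ℕ → α → ℝ≥0∞) (g : α → ℝ≥0∞), (∀ k, AEMeasurable (f k) μ) → AEMeasurable g μ →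
    (∀ᵐ x ∂μ, Monotone fun k => f k x) →
    (∀ᵐ x ∂μ, Tendsto (fun k => f k x) atTop (𝓝 (g x))) →
    Tendsto (fun k => ρ (f k)) atTop (𝓝 (ρ g))
  indicator_lt_top : ∀ s : Set α, MeasurableSet s → μ s < ⊤ →
    ρ (s.indicator fun _ => 1) < ⊤
  lintegral_le : ∀ s : Set α, MeasurableSet s → μ s < ⊤ →
    ∃ C : ℝ≥0, ∀ f : α → ℝ≥0∞, AEMeasurable f μ → ∫⁻ x in s, f x ∂μ ≤ (C : ℝ≥0∞) * ρ f

/-- A rearrangement invariant Banach function norm: equimeasurable functions (functions with the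
same distribution function) have the same norm. -/
structure IsRIBanachFunctionNorm {α : Type*} [MeasurableSpace α] (μ : Measure α)
    (ρ : (α → ℝ≥0∞) → ℝ≥0∞) : Prop extends IsBanachFunctionNorm μ ρ where
  rearrangement_invariant : ∀ f g : α → ℝ≥0∞, AEMeasurable f μ → AEMeasurable g μ →
    (∀ c : ℝ≥0, μ {x | (c : ℝ≥0∞) < f x} = μ {x | (c : ℝ≥0∞) < g x}) → ρ f = ρ g

/-- The non-increasing rearrangement
`f*(s) = inf {c : μ {f > c} ≤ s}` of a nonnegative function `f`. -/
noncomputable def rearrangement {α : Type*} [MeasurableSpace α] (μ : Measure α)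
    (f : α → ℝ≥0∞) (s : ℝ) : ℝ≥0∞ :=
  sInf {c : ℝ≥0∞ | μ {x | c < f x} ≤ ENNReal.ofReal s}

/-- The dilation operator `E_s` on functions on `(0, a)`:
`E_s h (x) = h (s x)` if `s x < a`, and `0` otherwise. -/
noncomputable def dilation (a s : ℝ) (h : ℝ → ℝ≥0∞) (x : ℝ) : ℝ≥0∞ :=
  if s * x < a then h (s * x) else 0

/-- Function norms `ρ` over `G` and `ρ'` over `G'` (sets of positive finite measure) are similar
if, with `η = |G'| / |G|`, one has `η ρ(f) = ρ'(g)` whenever `E_η (g*) = f*` on `(0, |G|)`. -/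
def SimilarNorms {n : ℕ} (G G' : Set (RSpace n))
    (ρ ρ' : (RSpace n → ℝ≥0∞) → ℝ≥0∞) : Prop :=
  ∀ f g : RSpace n → ℝ≥0∞,
    AEMeasurable f (volume.restrict G) → AEMeasurable g (volume.restrict G') →
    (∀ x ∈ Ioo (0 : ℝ) (volume.real G),
      dilation (volume.real G') (volume.real G' / volume.real G)
        (rearrangement (volume.restrict G') g) x = rearrangement (volume.restrict G) f x) →
    (volume G' / volume G) * ρ f = ρ' g

/-- The domains on which the function spaces live: nonempty open sets of finite measure. -/
structure IsFiniteDomain {n : ℕ} (G : Set (RSpace n)) : Prop where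
  isOpen : IsOpen G
  nonempty : G.Nonempty
  volume_lt_top : volume G < ⊤

/-- A rearrangement invariant Banach function space `X` on `ℝⁿ`: for each nonempty open set `G` of
finite measure an r.i. Banach function norm `X.norm G` over `G`, such that any two
of them are similar. The values of `norm` at other sets are irrelevant. -/
structure RIBanachFunctionSpace (n : ℕ) where
  norm : Set (RSpace n) → (RSpace n → ℝ≥0∞) → ℝ≥0∞
  isRI : ∀ G, IsFiniteDomain G → IsRIBanachFunctionNorm (volume.restrict G) (norm G)
  similar : ∀ G G', IsFiniteDomain G → IsFiniteDomain G' →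
    SimilarNorms G G' (norm G) (norm G')

/-- `u ∈ X(G)` for a vector valued function `u`: it is measurable on `G` and `‖ |u| ‖_{X(G)} < ∞`. -/
def RIBanachFunctionSpace.Mem {n : ℕ} (X : RIBanachFunctionSpace n) {F : Type*}
    [NormedAddCommGroup F] (G : Set (RSpace n)) (u : RSpace n → F) : Prop :=
  AEStronglyMeasurable u (volume.restrict G) ∧ X.norm G (fun x => ‖u x‖ₑ) < ⊤

/-- `v` is the weak derivative of `u` in the open set `G`: both are locally integrable in `G` and
`∫_G (∂_w φ) u = - ∫_G φ (v w)` for all test functions `φ ∈ C_c^∞(G)` and all directions `w`. -/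
structure HasWeakDerivOn {n : ℕ} {F : Type*} [NormedAddCommGroup F] [NormedSpace ℝ F]
    (G : Set (RSpace n)) (u : RSpace n → F) (v : RSpace n → RSpace n →L[ℝ] F) : Prop where
  locallyIntegrableOn : LocallyIntegrableOn u G volume
  locallyIntegrableOn_deriv : LocallyIntegrableOn v G volume
  integral_eq : ∀ φ : RSpace n → ℝ, ContDiff ℝ (⊤ : ℕ∞) φ → HasCompactSupport φ → tsupport φ ⊆ G →
    ∀ w : RSpace n, ∫ x in G, (fderiv ℝ φ x w) • u x = - ∫ x in G, φ x • v x w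

/-- `u ∈ W¹X(G)`: `u` is weakly differentiable in `G`, and `u` and `Du` belong to `X(G)`. -/
def MemW1 {n : ℕ} (X : RIBanachFunctionSpace n) {F : Type*} [NormedAddCommGroup F]
    [NormedSpace ℝ F] (G : Set (RSpace n)) (u : RSpace n → F) : Prop :=
  ∃ v : RSpace n → RSpace n →L[ℝ] F, HasWeakDerivOn G u v ∧ X.Mem G u ∧ X.Mem G v

/-- `u ∈ W¹X_loc(Ω)`: `u ∈ W¹X(G)` for all (nonempty) open `G` whose closure is a compact
subset of `Ω`. -/
def MemW1Loc {n : ℕ} (X : RIBanachFunctionSpace n) {F : Type*} [NormedAddCommGroup F]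
    [NormedSpace ℝ F] (Ω : Set (RSpace n)) (u : RSpace n → F) : Prop :=
  ∀ G : Set (RSpace n), IsOpen G → G.Nonempty → IsCompact (closure G) → closure G ⊆ Ω →
    MemW1 X G u

/-- `f` is bilipschitz on `Ω`. -/
def IsBilipschitzOn {n : ℕ} (f : RSpace n → RSpace n) (Ω : Set (RSpace n)) : Prop :=
  ∃ L : ℝ, 0 < L ∧ ∀ x ∈ Ω, ∀ y ∈ Ω,
    L⁻¹ * ‖x - y‖ ≤ ‖f x - f y‖ ∧ ‖f x - f y‖ ≤ L * ‖x - y‖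

/-!
Writing `g = f⁻¹`, one has `Dg = (Df)⁻¹ ∘ g` almost everywhere. Since `f` is bilipschitz, `Df` takes
values in the compact set of matrices which are bounded together with their inverses; there matrix
inversion agrees with a compactly supported smooth map `Φ`, so `Dg = Φ ∘ Df ∘ g` and the chain rule
bounds `|D²g|` by a constant times `|D²f| ∘ g`.

Since `g` distorts Lebesgue measure by at most a constant factor, the rearrangement of `|D²f| ∘ g`
is bounded by a dilation of that of `|D²f|`. No Boyd index enters because dilations are bounded on
every r.i. space over `(0, 1)`: `h (· / 2)` is equimeasurable with the sum of two disjoint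
translates of the restriction of `h` to `(0, 1 / 2)`, so its norm is at most twice that of `h`.
-/

section L1Convergence

variable {α β F : Type*} [MeasurableSpace α] [MeasurableSpace β] [NormedAddCommGroup F]
  {μ : Measure α} {ν : Measure β}

theorem tendsto_lintegral_enorm_sub_of_integral_norm_le {g : ℕ → α → F} {f : α → F}
    (hg : ∀ k, Integrable (g k) μ) (hf : Integrable f μ)
    (hle : ∀ k, ∫ x, ‖g k x‖ ∂μ ≤ ∫ x, ‖f x‖ ∂μ)
    (hlim : ∀ᵐ x ∂μ, Tendsto (fun k => g k x) atTop (𝓝 (f x))) :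
    Tendsto (fun k => ∫⁻ x, ‖g k x - f x‖ₑ ∂μ) atTop (𝓝 0) := by
  have defect_tendsto : Tendsto (fun k => ∫ x, (‖g k x‖ + ‖f x‖ - ‖g k x - f x‖) ∂μ) atTop
      (𝓝 (∫ x, (‖f x‖ + ‖f x‖) ∂μ)) := by
    refine tendsto_integral_of_dominated_convergence (fun x => ‖f x‖ + ‖f x‖)
      (fun k => (((hg k).norm.add hf.norm).sub ((hg k).sub hf).norm).aestronglyMeasurable)
      (hf.norm.add hf.norm) (fun k => Eventually.of_forall fun x => ?_) ?_
    · have upper := norm_sub_norm_le (g k x) (f x)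
      have lower := norm_sub_le (g k x) (f x)
      rw [Real.norm_eq_abs, abs_le]
      constructor <;> linarith [norm_nonneg (f x)]
    · filter_upwards [hlim] with x hx
      simpa using (hx.norm.add_const ‖f x‖).sub (hx.sub_const (f x)).norm
  have le_defect : ∀ k, ∫ x, ‖g k x - f x‖ ∂μ ≤
      ∫ x, (‖f x‖ + ‖f x‖) ∂μ - ∫ x, (‖g k x‖ + ‖f x‖ - ‖g k x - f x‖) ∂μ := fun k => by
    have split : ∫ x, (‖g k x‖ + ‖f x‖ - ‖g k x - f x‖) ∂μ =
        ∫ x, ‖g k x‖ ∂μ + ∫ x, ‖f x‖ ∂μ - ∫ x, ‖g k x - f x‖ ∂μ := by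
      rw [← integral_add (hg k).norm hf.norm]
      exact integral_sub ((hg k).norm.add hf.norm) ((hg k).sub hf).norm
    rw [split, integral_add hf.norm hf.norm]
    linarith [hle k]
  have integral_tendsto : Tendsto (fun k => ∫ x, ‖g k x - f x‖ ∂μ) atTop (𝓝 0) :=
    squeeze_zero (fun k => integral_nonneg fun x => norm_nonneg _) le_defect
      (by simpa using defect_tendsto.const_sub (∫ x, (‖f x‖ + ‖f x‖) ∂μ))
  have ofReal_integral : ∀ k, ENNReal.ofReal (∫ x, ‖g k x - f x‖ ∂μ) = ∫⁻ x, ‖g k x - f x‖ₑ ∂μ :=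
    fun k => ofReal_integral_norm_eq_lintegral_enorm ((hg k).sub hf)
  simpa only [ofReal_integral, ENNReal.ofReal_zero] using ENNReal.tendsto_ofReal integral_tendsto

theorem integrable_of_tendsto_lintegral_enorm_sub {g : ℕ → α → F} {f : α → F}
    (hg : ∀ k, Integrable (g k) μ) (hf : AEStronglyMeasurable f μ)
    (hlim : Tendsto (fun k => ∫⁻ x, ‖g k x - f x‖ₑ ∂μ) atTop (𝓝 0)) : Integrable f μ := by
  obtain ⟨k, hk⟩ := (hlim.eventually_lt_const ENNReal.zero_lt_top).exists
  have integrable_sub : Integrable (g k - f) μ := ⟨(hg k).aestronglyMeasurable.sub hf, hk⟩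
  simpa using (hg k).sub integrable_sub

theorem lintegral_comp_le_of_map_le_smul {g : α → β} (hg : AEMeasurable g μ) {c : ℝ≥0}
    (hmap : μ.map g ≤ c • ν) {f : β → ℝ≥0∞} (hf : AEMeasurable f ν) :
    ∫⁻ x, f (g x) ∂μ ≤ c * ∫⁻ y, f y ∂ν := by
  have hac : μ.map g ≪ ν := Measure.absolutelyContinuous_of_le_smul (c := (c : ℝ≥0∞)) hmap
  calc ∫⁻ x, f (g x) ∂μ = ∫⁻ y, f y ∂(μ.map g) := (lintegral_map' (hf.mono_ac hac) hg).symm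
    _ ≤ ∫⁻ y, f y ∂(c • ν) := lintegral_mono' hmap le_rfl
    _ = c * ∫⁻ y, f y ∂ν := lintegral_smul_measure (c : ℝ≥0∞) f

theorem ae_comp_of_map_le_smul {g : α → β} (hg : AEMeasurable g μ) {c : ℝ≥0}
    (hmap : μ.map g ≤ c • ν) {p : β → Prop} (hp : ∀ᵐ y ∂ν, p y) : ∀ᵐ x ∂μ, p (g x) :=
  ae_of_ae_map hg
    ((Measure.absolutelyContinuous_of_le_smul (c := (c : ℝ≥0∞)) hmap).ae_le hp)

theorem aestronglyMeasurable_comp_of_map_le_smul {g : α → β} (hg : AEMeasurable g μ) {c : ℝ≥0}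
    (hmap : μ.map g ≤ c • ν) {f : β → F} (hf : AEStronglyMeasurable f ν) :
    AEStronglyMeasurable (fun x => f (g x)) μ :=
  (hf.mono_ac (Measure.absolutelyContinuous_of_le_smul (c := (c : ℝ≥0∞)) hmap)).comp_aemeasurable hg

theorem tendsto_lintegral_enorm_comp_sub_of_map_le_smul {g : α → β} (hg : AEMeasurable g μ)
    {c : ℝ≥0} (hmap : μ.map g ≤ c • ν) {f : ℕ → β → F} {f₀ : β → F}
    (hf : ∀ k, AEStronglyMeasurable (f k) ν) (hf₀ : AEStronglyMeasurable f₀ ν)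
    (hlim : Tendsto (fun k => ∫⁻ y, ‖f k y - f₀ y‖ₑ ∂ν) atTop (𝓝 0)) :
    Tendsto (fun k => ∫⁻ x, ‖f k (g x) - f₀ (g x)‖ₑ ∂μ) atTop (𝓝 0) :=
  tendsto_const_nhds.squeeze
    (by simpa using ENNReal.Tendsto.const_mul hlim (Or.inr (ENNReal.coe_ne_top (r := c))))
    (fun _ => zero_le) fun k => lintegral_comp_le_of_map_le_smul hg hmap ((hf k).sub hf₀).enorm

section Operators

variable {E G : Type*} [NormedAddCommGroup E] [NormedSpace ℝ E] [NormedSpace ℝ F]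
  [NormedAddCommGroup G] [NormedSpace ℝ G] {A : ℕ → α → F →L[ℝ] G} {A₀ : α → F →L[ℝ] G}
  {B : ℕ → α → E →L[ℝ] F} {B₀ : α → E →L[ℝ] F} {M : ℝ≥0}

theorem tendsto_lintegral_enorm_clm_comp_of_ae_tendsto_zero
    (hA : ∀ k, AEStronglyMeasurable (A k) μ) (hAM : ∀ k x, ‖A k x‖ₑ ≤ M)
    (hAlim : ∀ᵐ x ∂μ, Tendsto (fun k => A k x) atTop (𝓝 0)) (hB₀ : Integrable B₀ μ) :
    Tendsto (fun k => ∫⁻ x, ‖(A k x).comp (B₀ x)‖ₑ ∂μ) atTop (𝓝 0) := by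
  rw [← lintegral_zero (α := α) (μ := μ)]
  refine tendsto_lintegral_of_dominated_convergence' (fun x => M * ‖B₀ x‖ₑ) (fun k => ?_)
    (fun k => .of_forall fun x => ?_) ?_ ?_
  · exact ((ContinuousLinearMap.compL ℝ E F G).aestronglyMeasurable_comp₂ (hA k)
      hB₀.aestronglyMeasurable).enorm
  · exact (ContinuousLinearMap.opENorm_comp_le _ _).trans (mul_le_mul_left (hAM k x) _)
  · rw [lintegral_const_mul' _ _ ENNReal.coe_ne_top]
    exact ENNReal.mul_ne_top ENNReal.coe_ne_top hB₀.2.ne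
  · filter_upwards [hAlim] with x hx
    have norm_mul_tendsto : Tendsto (fun k => ‖A k x‖ₑ * ‖B₀ x‖ₑ) atTop (𝓝 0) := by
      simpa only [zero_mul] using ENNReal.Tendsto.mul_const
        (tendsto_zero_iff_enorm_tendsto_zero.1 hx) (Or.inr (enorm_ne_top (x := B₀ x)))
    exact tendsto_const_nhds.squeeze norm_mul_tendsto (fun _ => zero_le)
      fun k => ContinuousLinearMap.opENorm_comp_le _ _

theorem tendsto_lintegral_enorm_clm_comp_sub
    (hA : ∀ k, AEStronglyMeasurable (A k) μ) (hA₀ : AEStronglyMeasurable A₀ μ)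
    (hAM : ∀ k x, ‖A k x‖ₑ ≤ M) (hA₀M : ∀ x, ‖A₀ x‖ₑ ≤ M)
    (hAlim : ∀ᵐ x ∂μ, Tendsto (fun k => A k x) atTop (𝓝 (A₀ x))) (hB₀ : Integrable B₀ μ)
    (hBlim : Tendsto (fun k => ∫⁻ x, ‖B k x - B₀ x‖ₑ ∂μ) atTop (𝓝 0)) :
    Tendsto (fun k => ∫⁻ x, ‖(A k x).comp (B k x) - (A₀ x).comp (B₀ x)‖ₑ ∂μ) atTop (𝓝 0) := by
  have main_tendsto : Tendsto (fun k => M * ∫⁻ x, ‖B k x - B₀ x‖ₑ ∂μ) atTop (𝓝 0) := by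
    simpa using ENNReal.Tendsto.const_mul hBlim (Or.inr ENNReal.coe_ne_top)
  have error_tendsto : Tendsto (fun k => ∫⁻ x, ‖(A k x - A₀ x).comp (B₀ x)‖ₑ ∂μ) atTop (𝓝 0) :=
    tendsto_lintegral_enorm_clm_comp_of_ae_tendsto_zero (M := M + M) (fun k => (hA k).sub hA₀)
      (fun k x => (enorm_sub_le (E := F →L[ℝ] G)).trans (add_le_add (hAM k x) (hA₀M x)))
      (hAlim.mono fun x hx => tendsto_sub_nhds_zero_iff.2 hx) hB₀
  have measurable_error (k : ℕ) : AEMeasurable (fun x => ‖(A k x - A₀ x).comp (B₀ x)‖ₑ) μ :=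
    ((ContinuousLinearMap.compL ℝ E F G).aestronglyMeasurable_comp₂ ((hA k).sub hA₀)
      hB₀.aestronglyMeasurable).enorm
  refine tendsto_const_nhds.squeeze (by simpa only [add_zero] using main_tendsto.add error_tendsto)
    (fun _ => zero_le) fun k => ?_
  rw [← lintegral_const_mul' _ _ ENNReal.coe_ne_top, ← lintegral_add_right' _ (measurable_error k)]
  refine lintegral_mono fun x => ?_
  have decomposition : (A k x).comp (B k x) - (A₀ x).comp (B₀ x) =
      (A k x).comp (B k x - B₀ x) + (A k x - A₀ x).comp (B₀ x) := by
    rw [ContinuousLinearMap.comp_sub, ContinuousLinearMap.sub_comp]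
    abel
  calc ‖(A k x).comp (B k x) - (A₀ x).comp (B₀ x)‖ₑ
      ≤ ‖(A k x).comp (B k x - B₀ x)‖ₑ + ‖(A k x - A₀ x).comp (B₀ x)‖ₑ := by
        rw [decomposition]
        exact enorm_add_le (E := E →L[ℝ] G) _ _
    _ ≤ M * ‖B k x - B₀ x‖ₑ + ‖(A k x - A₀ x).comp (B₀ x)‖ₑ := by
        gcongr
        exact (ContinuousLinearMap.opENorm_comp_le _ _).trans (mul_le_mul_left (hAM k x) _)

end Operators

end L1Convergence

section LipschitzImages

theorem addHaar_image_le_of_lipschitzOnWith {E : Type*} [NormedAddCommGroup E] [NormedSpace ℝ E]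
    [FiniteDimensional ℝ E] [MeasurableSpace E] [BorelSpace E] (μ : Measure E) [μ.IsAddHaarMeasure]
    {f : E → E} {K : ℝ≥0} {s : Set E} (hf : LipschitzOnWith K f s) :
    μ (f '' s) ≤ (K ^ Module.finrank ℝ E : ℝ≥0) * μ s := by
  set d := Module.finrank ℝ E
  have : (Measure.hausdorffMeasure (d : ℝ) : Measure E).IsAddHaarMeasure :=
    isAddHaarMeasure_hausdorffMeasure
  set c := μ.addHaarScalarFactor (Measure.hausdorffMeasure (d : ℝ))
  have hμ : ∀ t, μ t = c * Measure.hausdorffMeasure (d : ℝ) t := fun t =>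
    DFunLike.congr_fun (Measure.isAddLeftInvariant_eq_smul μ (Measure.hausdorffMeasure (d : ℝ))) t
  calc μ (f '' s) = c * Measure.hausdorffMeasure (d : ℝ) (f '' s) := hμ _
    _ ≤ c * ((K : ℝ≥0∞) ^ (d : ℝ) * Measure.hausdorffMeasure (d : ℝ) s) := by
      gcongr
      exact hf.hausdorffMeasure_image_le (Nat.cast_nonneg d)
    _ = (K ^ d : ℝ≥0) * μ s := by
      rw [hμ, ENNReal.rpow_natCast, ENNReal.coe_pow]
      ring

theorem map_restrict_le_of_lipschitzOnWith_leftInverse {E : Type*} [NormedAddCommGroup E]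
    [NormedSpace ℝ E] [FiniteDimensional ℝ E] [MeasurableSpace E] [BorelSpace E] {μ : Measure E}
    [μ.IsAddHaarMeasure] {f g : E → E} {K : ℝ≥0} {s : Set E} (hs : MeasurableSet s)
    (hg : AEMeasurable g (μ.restrict s)) (hfg : LeftInvOn f g s)
    (hf : LipschitzOnWith K f (g '' s)) :
    (μ.restrict s).map g ≤ (K ^ Module.finrank ℝ E : ℝ≥0) • μ.restrict (g '' s) := by
  refine Measure.le_iff.2 fun t ht => ?_
  have preimage_subset : g ⁻¹' t ∩ s ⊆ f '' (t ∩ g '' s) := fun y ⟨hyt, hys⟩ =>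
    ⟨g y, ⟨hyt, mem_image_of_mem g hys⟩, hfg hys⟩
  calc (μ.restrict s).map g t = μ (g ⁻¹' t ∩ s) := by
        rw [Measure.map_apply_of_aemeasurable hg ht, Measure.restrict_apply' hs]
    _ ≤ μ (f '' (t ∩ g '' s)) := measure_mono preimage_subset
    _ ≤ (K ^ Module.finrank ℝ E : ℝ≥0) * μ (t ∩ g '' s) :=
        addHaar_image_le_of_lipschitzOnWith μ (hf.mono inter_subset_right)
    _ = ((K ^ Module.finrank ℝ E : ℝ≥0) • μ.restrict (g '' s)) t := by
        rw [Measure.smul_apply, Measure.restrict_apply ht, ENNReal.smul_def, smul_eq_mul]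

theorem aemeasurable_symm_restrict {E : Type*} [TopologicalSpace E] [MeasurableSpace E]
    [BorelSpace E] {μ : Measure E} (e : OpenPartialHomeomorph E E) {s : Set E}
    (hse : s ⊆ e.target) : AEMeasurable e.symm (μ.restrict s) :=
  (e.continuousOn_symm.aemeasurable e.open_target.measurableSet).mono_set hse

theorem map_symm_restrict_le_of_lipschitzOnWith {E : Type*} [NormedAddCommGroup E]
    [NormedSpace ℝ E] [FiniteDimensional ℝ E] [MeasurableSpace E] [BorelSpace E] {μ : Measure E}
    [μ.IsAddHaarMeasure] {e : OpenPartialHomeomorph E E} {K : ℝ≥0}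
    (he : LipschitzOnWith K e e.source) {s : Set E} (hs : MeasurableSet s) (hse : s ⊆ e.target) :
    (μ.restrict s).map e.symm ≤
      (K ^ Module.finrank ℝ E : ℝ≥0) • μ.restrict (e.symm '' s) :=
  map_restrict_le_of_lipschitzOnWith_leftInverse hs (aemeasurable_symm_restrict e hse)
    (fun _ hy => e.right_inv (hse hy))
    (he.mono (image_subset_iff.2 fun _ hy => e.map_target (hse hy)))

theorem map_symm_restrict_target_le_of_lipschitzOnWith {E : Type*} [NormedAddCommGroup E]
    [NormedSpace ℝ E] [FiniteDimensional ℝ E] [MeasurableSpace E] [BorelSpace E] {μ : Measure E}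
    [μ.IsAddHaarMeasure] {e : OpenPartialHomeomorph E E} {K : ℝ≥0}
    (he : LipschitzOnWith K e e.source) :
    (μ.restrict e.target).map e.symm ≤
      (K ^ Module.finrank ℝ E : ℝ≥0) • μ.restrict e.source :=
  e.symm_image_target_eq_source ▸
    map_symm_restrict_le_of_lipschitzOnWith he e.open_target.measurableSet subset_rfl

end LipschitzImages

section IntegralsAgainstTestFunctions

variable {α F : Type*} [TopologicalSpace α] [MeasurableSpace α] [NormedAddCommGroup F]
  [NormedSpace ℝ F] {μ : Measure α} {Ω : Set α} {φ : α → ℝ}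

theorem setIntegral_smul_eq_integral_of_tsupport_subset (hs : tsupport φ ⊆ Ω) (h : α → F) :
    ∫ x in Ω, φ x • h x ∂μ = ∫ x, φ x • h x ∂μ :=
  setIntegral_eq_integral_of_forall_compl_eq_zero fun x hx => by
    rw [image_eq_zero_of_notMem_tsupport fun hxs => hx (hs hxs), zero_smul]

variable [T2Space α] [OpensMeasurableSpace α]

theorem integrable_smul_of_tsupport_subset {h : α → F} (hh : LocallyIntegrableOn h Ω μ)
    (hφ : Continuous φ) (hc : HasCompactSupport φ) (hs : tsupport φ ⊆ Ω) :
    Integrable (fun x => φ x • h x) μ := by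
  refine (integrableOn_iff_integrable_of_support_subset ?_).1
    ((hh.integrableOn_compact_subset hs hc).continuousOn_smul hφ.continuousOn hc)
  exact (Function.support_smul_subset_left φ h).trans (subset_tsupport φ)

theorem tendsto_setIntegral_smul_of_tsupport_subset {h : ℕ → α → F} {h₀ : α → F}
    (hh : ∀ k, LocallyIntegrableOn (h k) Ω μ) (hh₀ : LocallyIntegrableOn h₀ Ω μ)
    (hφ : Continuous φ) (hc : HasCompactSupport φ) (hs : tsupport φ ⊆ Ω)
    (hlim : Tendsto (fun k => ∫⁻ x in tsupport φ, ‖h k x - h₀ x‖ₑ ∂μ) atTop (𝓝 0)) :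
    Tendsto (fun k => ∫ x in Ω, φ x • h k x ∂μ) atTop (𝓝 (∫ x in Ω, φ x • h₀ x ∂μ)) := by
  obtain ⟨C, hC⟩ := hc.exists_bound_of_continuous hφ
  have setIntegral_eq : ∀ f : α → F, ∫ x in Ω, φ x • f x ∂μ = ∫ x in tsupport φ, φ x • f x ∂μ :=
    fun f => (setIntegral_smul_eq_integral_of_tsupport_subset hs f).trans
      (setIntegral_smul_eq_integral_of_tsupport_subset subset_rfl f).symm
  simp only [setIntegral_eq]
  refine tendsto_integral_of_L1 _
    (integrable_smul_of_tsupport_subset hh₀ hφ hc hs).restrict.aestronglyMeasurable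
    (Eventually.of_forall fun k => (integrable_smul_of_tsupport_subset (hh k) hφ hc hs).restrict) ?_
  have bound : ∀ k, ∫⁻ x in tsupport φ, ‖φ x • h k x - φ x • h₀ x‖ₑ ∂μ ≤
      ENNReal.ofReal C * ∫⁻ x in tsupport φ, ‖h k x - h₀ x‖ₑ ∂μ := fun k => by
    rw [← lintegral_const_mul' _ _ ENNReal.ofReal_ne_top]
    refine lintegral_mono fun x => ?_
    rw [← smul_sub, enorm_smul, ← ofReal_norm (φ x)]
    gcongr
    exact hC x
  exact tendsto_const_nhds.squeeze
    (by simpa using ENNReal.Tendsto.const_mul hlim (Or.inr ENNReal.ofReal_ne_top))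
    (fun _ => zero_le) bound

end IntegralsAgainstTestFunctions

section WeakDerivatives

variable {n : ℕ} {F : Type*} [NormedAddCommGroup F] [NormedSpace ℝ F] {Ω : Set (RSpace n)}
  {u u' : RSpace n → F} {v v' : RSpace n → RSpace n →L[ℝ] F}

theorem locallyIntegrableOn_clm_apply (hv : LocallyIntegrableOn v Ω volume) (w : RSpace n) :
    LocallyIntegrableOn (fun x => v x w) Ω volume := fun x hx =>
  let ⟨s, hs, hi⟩ := hv x hx
  ⟨s, hs, (ContinuousLinearMap.apply ℝ F w).integrable_comp hi⟩

namespace HasWeakDerivOn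

theorem congr (h : HasWeakDerivOn Ω u v) (hu : u =ᵐ[volume.restrict Ω] u')
    (hv : v =ᵐ[volume.restrict Ω] v') : HasWeakDerivOn Ω u' v' where
  locallyIntegrableOn := h.locallyIntegrableOn.congr hu
  locallyIntegrableOn_deriv := h.locallyIntegrableOn_deriv.congr hv
  integral_eq φ hφ hc hs w := by
    have lhs_eq : (fun x => fderiv ℝ φ x w • u' x) =ᵐ[volume.restrict Ω]
        fun x => fderiv ℝ φ x w • u x := by
      filter_upwards [hu] with x hx
      rw [hx]
    have rhs_eq : (fun x => φ x • v' x w) =ᵐ[volume.restrict Ω] fun x => φ x • v x w := by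
      filter_upwards [hv] with x hx
      rw [hx]
    rw [integral_congr_ae lhs_eq, integral_congr_ae rhs_eq, h.integral_eq φ hφ hc hs w]

theorem ae_eq [CompleteSpace F] (hΩ : IsOpen Ω) (h : HasWeakDerivOn Ω u v)
    (h' : HasWeakDerivOn Ω u v') : v =ᵐ[volume.restrict Ω] v' := by
  rw [EventuallyEq, ae_restrict_iff' hΩ.measurableSet]
  have sub_ae_zero : ∀ᵐ x, x ∈ Ω → v x - v' x = 0 := by
    refine hΩ.ae_eq_zero_of_integral_contDiff_smul_eq_zero
      (h.locallyIntegrableOn_deriv.sub h'.locallyIntegrableOn_deriv) fun φ hφ hc hs => ?_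
    have integrable_v := integrable_smul_of_tsupport_subset h.locallyIntegrableOn_deriv
      hφ.continuous hc hs
    have integrable_v' := integrable_smul_of_tsupport_subset h'.locallyIntegrableOn_deriv
      hφ.continuous hc hs
    have integral_eq : ∫ x, φ x • v x = ∫ x, φ x • v' x := by
      ext w
      rw [ContinuousLinearMap.integral_apply integrable_v,
        ContinuousLinearMap.integral_apply integrable_v']
      have tested := (h.integral_eq φ hφ hc hs w).symm.trans (h'.integral_eq φ hφ hc hs w)
      rwa [neg_inj, setIntegral_smul_eq_integral_of_tsupport_subset hs,
        setIntegral_smul_eq_integral_of_tsupport_subset hs] at tested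
    simp only [smul_sub]
    rw [integral_sub integrable_v integrable_v', integral_eq, sub_self]
  filter_upwards [sub_ae_zero] with x hx hxΩ using sub_eq_zero.1 (hx hxΩ)

theorem of_forall_isCompact_tendsto (hΩ : IsOpen Ω)
    (hu : AEStronglyMeasurable u (volume.restrict Ω))
    (hv : AEStronglyMeasurable v (volume.restrict Ω))
    (happrox : ∀ S ⊆ Ω, IsCompact S →
      ∃ (a : ℕ → RSpace n → F) (b : ℕ → RSpace n → RSpace n →L[ℝ] F),
        (∀ k, HasWeakDerivOn Ω (a k) (b k)) ∧
        Tendsto (fun k => ∫⁻ x in S, ‖a k x - u x‖ₑ) atTop (𝓝 0) ∧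
        Tendsto (fun k => ∫⁻ x in S, ‖b k x - v x‖ₑ) atTop (𝓝 0)) :
    HasWeakDerivOn Ω u v := by
  have locallyIntegrable_u : LocallyIntegrableOn u Ω volume :=
    (locallyIntegrableOn_iff hΩ.isLocallyClosed).2 fun S hSΩ hS =>
      let ⟨_, _, hab, ha, _⟩ := happrox S hSΩ hS
      integrable_of_tendsto_lintegral_enorm_sub (fun k =>
        (hab k).locallyIntegrableOn.integrableOn_compact_subset hSΩ hS) (hu.mono_set hSΩ) ha
  have locallyIntegrable_v : LocallyIntegrableOn v Ω volume :=
    (locallyIntegrableOn_iff hΩ.isLocallyClosed).2 fun S hSΩ hS =>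
      let ⟨_, _, hab, _, hb⟩ := happrox S hSΩ hS
      integrable_of_tendsto_lintegral_enorm_sub (fun k =>
        (hab k).locallyIntegrableOn_deriv.integrableOn_compact_subset hSΩ hS) (hv.mono_set hSΩ) hb
  refine ⟨locallyIntegrable_u, locallyIntegrable_v, fun φ hφ hc hs w => ?_⟩
  obtain ⟨a, b, hab, ha, hb⟩ := happrox (tsupport φ) hs hc
  have tsupport_deriv : tsupport (fun x => fderiv ℝ φ x w) ⊆ tsupport φ :=
    tsupport_fderiv_apply_subset ℝ w
  have lhs_tendsto := tendsto_setIntegral_smul_of_tsupport_subset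
    (fun k => (hab k).locallyIntegrableOn) locallyIntegrable_u
    ((hφ.continuous_fderiv (by simp)).clm_apply continuous_const) (hc.fderiv_apply ℝ w)
    (tsupport_deriv.trans hs)
    (tendsto_const_nhds.squeeze ha (fun _ => zero_le)
      fun k => lintegral_mono_set tsupport_deriv)
  have rhs_tendsto := tendsto_setIntegral_smul_of_tsupport_subset
    (fun k => locallyIntegrableOn_clm_apply (hab k).locallyIntegrableOn_deriv w)
    (locallyIntegrableOn_clm_apply locallyIntegrable_v w) hφ.continuous hc hs
    (tendsto_const_nhds.squeeze
      (by simpa using ENNReal.Tendsto.const_mul hb (Or.inr (enorm_ne_top (x := w))))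
      (fun _ => zero_le) fun k => by
        rw [← lintegral_const_mul' _ _ enorm_ne_top]
        refine lintegral_mono fun x => ?_
        rw [mul_comm]
        exact (b k x - v x).le_opENorm w)
  exact tendsto_nhds_unique lhs_tendsto
    (rhs_tendsto.neg.congr fun k => ((hab k).integral_eq φ hφ hc hs w).symm)

end HasWeakDerivOn

theorem locallyIntegrable_fderiv_of_lipschitzWith [FiniteDimensional ℝ F] {C : ℝ≥0}
    (hu : LipschitzWith C u) : LocallyIntegrable (fderiv ℝ u) volume := by
  have : CompleteSpace F := FiniteDimensional.complete ℝ F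
  borelize F
  exact (memLp_top_of_bound (measurable_fderiv ℝ u).aestronglyMeasurable C
    (Eventually.of_forall fun x => norm_fderiv_le_of_lipschitz ℝ hu)).locallyIntegrable le_top

theorem integral_fderiv_smul_eq_of_lipschitzWith [FiniteDimensional ℝ F] {C : ℝ≥0}
    (hu : LipschitzWith C u) {φ : RSpace n → ℝ} (hφ : ContDiff ℝ (⊤ : ℕ∞) φ)
    (hc : HasCompactSupport φ) (w : RSpace n) :
    ∫ x, (fderiv ℝ φ x w) • u x = - ∫ x, φ x • fderiv ℝ u x w := by
  have : CompleteSpace F := FiniteDimensional.complete ℝ F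
  have integrable_left : Integrable (fun x => fderiv ℝ φ x w • u x) volume :=
    integrable_smul_of_tsupport_subset
      (hu.continuous.locallyIntegrable.locallyIntegrableOn univ)
      ((hφ.continuous_fderiv (by simp)).clm_apply continuous_const) (hc.fderiv_apply ℝ w)
      (subset_univ _)
  have integrable_right : Integrable (fun x => φ x • fderiv ℝ u x w) volume :=
    integrable_smul_of_tsupport_subset (locallyIntegrableOn_clm_apply
      ((locallyIntegrable_fderiv_of_lipschitzWith hu).locallyIntegrableOn univ) w)
      hφ.continuous hc (subset_univ _)
  rw [SeparatingDual.eq_iff_forall_dual_eq (R := ℝ)]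
  intro l
  rw [map_neg, ← l.integral_comp_comm integrable_left, ← l.integral_comp_comm integrable_right]
  obtain ⟨D, hD⟩ := hφ.lipschitzWith_of_hasCompactSupport hc (by simp)
  calc ∫ x, l (fderiv ℝ φ x w • u x) = - ∫ x, lineDeriv ℝ φ x (-w) * l (u x) := by
        rw [← integral_neg]
        congr 1
        ext x
        simp [(hφ.differentiable (by simp) x).lineDeriv_eq_fderiv]
    _ = - ∫ x, lineDeriv ℝ (fun x => l (u x)) x w * φ x :=
        congrArg Neg.neg ((l.lipschitz.comp hu).integral_lineDeriv_mul_eq hD hc w).symm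
    _ = - ∫ x, l (φ x • fderiv ℝ u x w) := by
        congr 1
        refine integral_congr_ae ?_
        filter_upwards [hu.ae_differentiableAt (μ := volume)] with x hx
        have hlu : HasFDerivAt (fun x => l (u x)) (l.comp (fderiv ℝ u x)) x :=
          l.hasFDerivAt.comp x hx.hasFDerivAt
        simp [(hlu.hasLineDerivAt w).lineDeriv, mul_comm]

theorem HasWeakDerivOn.of_lipschitzOnWith [FiniteDimensional ℝ F] {C : ℝ≥0} (hΩ : IsOpen Ω)
    (hu : LipschitzOnWith C u Ω) : HasWeakDerivOn Ω u (fderiv ℝ u) := by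
  obtain ⟨u', hu', heq⟩ := hu.extend_finite_dimension
  have weakDeriv_u' : HasWeakDerivOn Ω u' (fderiv ℝ u') :=
    { locallyIntegrableOn := hu'.continuous.locallyIntegrable.locallyIntegrableOn _
      locallyIntegrableOn_deriv :=
        (locallyIntegrable_fderiv_of_lipschitzWith hu').locallyIntegrableOn _
      integral_eq := fun φ hφ hc hs w => by
        rw [setIntegral_smul_eq_integral_of_tsupport_subset hs,
          setIntegral_smul_eq_integral_of_tsupport_subset
            ((tsupport_fderiv_apply_subset ℝ w).trans hs)]
        exact integral_fderiv_smul_eq_of_lipschitzWith hu' hφ hc w }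
  refine weakDeriv_u'.congr ?_ ?_ <;>
    filter_upwards [ae_restrict_mem hΩ.measurableSet] with x hx
  · exact (heq hx).symm
  · exact (heq.eventuallyEq_of_mem (hΩ.mem_nhds hx)).symm.fderiv_eq

end WeakDerivatives

section Mollification

open ContinuousLinearMap (lsmul)
open scoped Convolution

variable {E F : Type*} [NormedAddCommGroup E] [NormedSpace ℝ E] [FiniteDimensional ℝ E]
  [MeasurableSpace E] {μ : Measure E} [NormedAddCommGroup F] [NormedSpace ℝ F]
  {η : ContDiffBump (0 : E)} {h : E → F}

theorem contDiff_normed_const_sub (x : E) :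
    ContDiff ℝ (⊤ : ℕ∞) fun t => η.normed μ (x - t) :=
  η.contDiff_normed.comp (contDiff_const.sub contDiff_id)

theorem fderiv_normed_const_sub_apply (x t w : E) :
    fderiv ℝ (fun t => η.normed μ (x - t)) t w = -fderiv ℝ (η.normed μ) (x - t) w := by
  have normed_hasFDerivAt : HasFDerivAt (η.normed μ) (fderiv ℝ (η.normed μ) (x - t)) (x - t) :=
    ((η.contDiff_normed (n := 1)).differentiable (by simp) _).hasFDerivAt
  have kernel_hasFDerivAt : HasFDerivAt (fun t => η.normed μ (x - t)) _ t :=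
    normed_hasFDerivAt.comp t ((hasFDerivAt_id t).const_sub x)
  simp [kernel_hasFDerivAt.fderiv]

variable [BorelSpace E] [μ.IsAddHaarMeasure]

theorem tsupport_normed_const_sub_subset (x : E) :
    tsupport (fun t => η.normed μ (x - t)) ⊆ Metric.closedBall x η.rOut := by
  refine closure_minimal (fun t ht => ?_) Metric.isClosed_closedBall
  have hxt : x - t ∈ Function.support (η.normed μ) := ht
  rw [η.support_normed_eq, mem_ball_zero_iff] at hxt
  exact mem_closedBall_iff_norm'.2 hxt.le

/-- The mollification of `h` by the bump function `η`, normalised to have integral one. -/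
noncomputable def mollify (η : ContDiffBump (0 : E)) (μ : Measure E) (h : E → F) : E → F :=
  η.normed μ ⋆[lsmul ℝ ℝ, μ] h

theorem mollify_apply (x : E) : mollify η μ h x = ∫ t, η.normed μ (x - t) • h t ∂μ :=
  convolution_eq_swap _

theorem contDiff_mollify (hh : LocallyIntegrable h μ) {m : ℕ∞} : ContDiff ℝ m (mollify η μ h) :=
  η.hasCompactSupport_normed.contDiff_convolution_left _ η.contDiff_normed hh

theorem hasCompactSupport_mollify (hh : HasCompactSupport h) :
    HasCompactSupport (mollify η μ h) :=
  η.hasCompactSupport_normed.convolution _ hh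

theorem integrable_mollify (hh : Integrable h μ) : Integrable (mollify η μ h) μ :=
  η.integrable_normed.integrable_convolution _ hh

theorem integral_norm_mollify_le (hh : Integrable h μ) :
    ∫ x, ‖mollify η μ h x‖ ∂μ ≤ ∫ x, ‖h x‖ ∂μ := by
  have norm_mollify_le : ∀ x, ‖mollify η μ h x‖ ≤ mollify η μ (fun t => ‖h t‖) x := fun x => by
    refine (norm_integral_le_integral_norm _).trans_eq (integral_congr_ae (.of_forall fun t => ?_))
    simp [norm_smul, abs_of_nonneg (η.nonneg_normed t)]
  calc ∫ x, ‖mollify η μ h x‖ ∂μ ≤ ∫ x, mollify η μ (fun t => ‖h t‖) x ∂μ :=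
        integral_mono (integrable_mollify hh).norm (integrable_mollify hh.norm) norm_mollify_le
    _ = ∫ x, ‖h x‖ ∂μ := by
        simp [mollify, integral_convolution _ η.integrable_normed hh.norm, η.integral_normed]

theorem ae_tendsto_mollify [CompleteSpace F] {η : ℕ → ContDiffBump (0 : E)} {K : ℝ}
    (hrOut : Tendsto (fun k => (η k).rOut) atTop (𝓝 0)) (hK : ∀ k, (η k).rOut ≤ K * (η k).rIn)
    (hh : LocallyIntegrable h μ) :
    ∀ᵐ x ∂μ, Tendsto (fun k => mollify (η k) μ h x) atTop (𝓝 (h x)) :=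
  ContDiffBump.ae_convolution_tendsto_right_of_locallyIntegrable hrOut (.of_forall hK) hh

theorem tendsto_lintegral_enorm_mollify_sub [CompleteSpace F] {η : ℕ → ContDiffBump (0 : E)}
    {K : ℝ} (hrOut : Tendsto (fun k => (η k).rOut) atTop (𝓝 0))
    (hK : ∀ k, (η k).rOut ≤ K * (η k).rIn) (hh : Integrable h μ) :
    Tendsto (fun k => ∫⁻ x, ‖mollify (η k) μ h x - h x‖ₑ ∂μ) atTop (𝓝 0) :=
  tendsto_lintegral_enorm_sub_of_integral_norm_le (fun _ => integrable_mollify hh) hh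
    (fun _ => integral_norm_mollify_le hh)
    (ae_tendsto_mollify hrOut hK hh.locallyIntegrable)

theorem fderiv_mollify_apply (hh : LocallyIntegrable h μ) (x w : E) :
    fderiv ℝ (mollify η μ h) x w =
      -∫ t, fderiv ℝ (fun t => η.normed μ (x - t)) t w • h t ∂μ := by
  have hasFDerivAt_mollify := (η.hasCompactSupport_normed (μ := μ)).hasFDerivAt_convolution_left
    (lsmul ℝ ℝ : ℝ →L[ℝ] F →L[ℝ] F) (η.contDiff_normed (n := 1)) hh x
  have convolutionExists := ((η.hasCompactSupport_normed (μ := μ)).fderiv ℝ).convolutionExists_left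
    ((lsmul ℝ ℝ : ℝ →L[ℝ] F →L[ℝ] F).precompL E)
    ((η.contDiff_normed (n := 1)).continuous_fderiv (by simp)) hh x
  rw [mollify, hasFDerivAt_mollify.fderiv, convolution_eq_swap,
    ContinuousLinearMap.integral_apply convolutionExists.integrable_swap, ← integral_neg]
  simp only [ContinuousLinearMap.precompL_apply, ContinuousLinearMap.lsmul_apply,
    fderiv_normed_const_sub_apply, neg_smul, neg_neg]

theorem mollify_apply_clm_apply {h : E → E →L[ℝ] F} (hh : LocallyIntegrable h μ) (x w : E) :
    mollify η μ h x w = ∫ t, η.normed μ (x - t) • h t w ∂μ := by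
  rw [mollify_apply]
  exact ContinuousLinearMap.integral_apply
    ((η.hasCompactSupport_normed (μ := μ)).convolutionExists_left
      (lsmul ℝ ℝ) (η.contDiff_normed (n := 1)).continuous hh x).integrable_swap w

end Mollification

section SmoothApproximation

variable {n : ℕ} {F : Type*} [NormedAddCommGroup F] [NormedSpace ℝ F]
  {Ω S T : Set (RSpace n)} {u : RSpace n → F} {v : RSpace n → RSpace n →L[ℝ] F}

theorem smul_indicator_of_tsupport_subset {α : Type*} [TopologicalSpace α] {φ : α → ℝ} {s : Set α}
    (hφ : tsupport φ ⊆ s) (h : α → F) (x : α) : φ x • s.indicator h x = φ x • h x := by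
  by_cases hx : x ∈ s
  · rw [indicator_of_mem hx]
  · simp [image_eq_zero_of_notMem_tsupport fun hxφ => hx (hφ hxφ)]

theorem integrable_indicator_of_isCompact {α G : Type*} [TopologicalSpace α] [T2Space α]
    [MeasurableSpace α] [OpensMeasurableSpace α] [NormedAddCommGroup G] {μ : Measure α}
    {h : α → G} {s t : Set α} (hh : LocallyIntegrableOn h s μ) (ht : IsCompact t) (hts : t ⊆ s) :
    Integrable (t.indicator h) μ :=
  (hh.integrableOn_compact_subset hts ht).integrable_indicator ht.measurableSet

namespace HasWeakDerivOn

theorem fderiv_mollify_indicator (h : HasWeakDerivOn Ω u v) (hT : IsCompact T) (hTΩ : T ⊆ Ω)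
    {η : ContDiffBump (0 : RSpace n)} {x : RSpace n} (hx : Metric.closedBall x η.rOut ⊆ T) :
    fderiv ℝ (mollify η volume (T.indicator u)) x = mollify η volume (T.indicator v) x := by
  ext1 w
  set ψ : RSpace n → ℝ := fun t => η.normed volume (x - t)
  have hψT : tsupport ψ ⊆ T := (tsupport_normed_const_sub_subset x).trans hx
  have hψc : HasCompactSupport ψ := hT.of_isClosed_subset (isClosed_tsupport ψ) hψT
  have hψ'T : tsupport (fun t => fderiv ℝ ψ t w) ⊆ T := (tsupport_fderiv_apply_subset ℝ w).trans hψT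
  have hu := (integrable_indicator_of_isCompact h.locallyIntegrableOn hT hTΩ).locallyIntegrable
  have hv :=
    (integrable_indicator_of_isCompact h.locallyIntegrableOn_deriv hT hTΩ).locallyIntegrable
  calc fderiv ℝ (mollify η volume (T.indicator u)) x w
      = -∫ t, fderiv ℝ ψ t w • T.indicator u t := fderiv_mollify_apply hu x w
    _ = -∫ t, fderiv ℝ ψ t w • u t := by simp only [smul_indicator_of_tsupport_subset hψ'T]
    _ = -∫ t in Ω, fderiv ℝ ψ t w • u t := by
        rw [setIntegral_smul_eq_integral_of_tsupport_subset (hψ'T.trans hTΩ)]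
    _ = ∫ t in Ω, ψ t • v t w := by
        rw [h.integral_eq ψ (contDiff_normed_const_sub x) hψc (hψT.trans hTΩ) w, neg_neg]
    _ = ∫ t, ψ t • v t w := setIntegral_smul_eq_integral_of_tsupport_subset (hψT.trans hTΩ) _
    _ = ∫ t, ψ t • T.indicator v t w := by
        congr 1
        ext t
        exact congrArg (· w) (smul_indicator_of_tsupport_subset hψT v t).symm
    _ = mollify η volume (T.indicator v) x w := (mollify_apply_clm_apply hv x w).symm

theorem exists_contDiff_tendsto [CompleteSpace F] (hΩ : IsOpen Ω) (h : HasWeakDerivOn Ω u v)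
    (hS : IsCompact S) (hSΩ : S ⊆ Ω) :
    ∃ a : ℕ → RSpace n → F, (∀ k, ContDiff ℝ 1 (a k)) ∧ (∀ k, HasCompactSupport (a k)) ∧
      (∀ᵐ x ∂volume.restrict S, Tendsto (fun k => a k x) atTop (𝓝 (u x))) ∧
      Tendsto (fun k => ∫⁻ x in S, ‖a k x - u x‖ₑ) atTop (𝓝 0) ∧
      Tendsto (fun k => ∫⁻ x in S, ‖fderiv ℝ (a k) x - v x‖ₑ) atTop (𝓝 0) := by
  obtain ⟨δ, hδ, hTΩ⟩ := hS.exists_cthickening_subset_open hΩ hSΩ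
  set T := Metric.cthickening δ S
  have hT : IsCompact T := hS.cthickening
  have hST : S ⊆ T := Metric.self_subset_cthickening S
  have hu := integrable_indicator_of_isCompact h.locallyIntegrableOn hT hTΩ
  have hv := integrable_indicator_of_isCompact h.locallyIntegrableOn_deriv hT hTΩ
  let η (k : ℕ) : ContDiffBump (0 : RSpace n) :=
    ⟨δ / (k + 1) / 2, δ / (k + 1), by positivity, half_lt_self (by positivity)⟩
  have rOut_tendsto : Tendsto (fun k => (η k).rOut) atTop (𝓝 0) := by
    simpa [η, div_eq_mul_inv] using
      (tendsto_one_div_add_atTop_nhds_zero_nat (𝕜 := ℝ)).const_mul δ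
  have rOut_le (k : ℕ) : (η k).rOut ≤ δ := div_le_self hδ.le (by linarith [k.cast_nonneg (α := ℝ)])
  have rOut_le_rIn (k : ℕ) : (η k).rOut ≤ 2 * (η k).rIn := (mul_div_cancel₀ _ two_ne_zero).ge
  refine ⟨fun k => mollify (η k) volume (T.indicator u),
    fun k => contDiff_mollify hu.locallyIntegrable,
    fun k => hasCompactSupport_mollify (HasCompactSupport.intro hT fun x hx =>
      indicator_of_notMem hx u), ?_, ?_, ?_⟩
  · filter_upwards [ae_restrict_mem hS.measurableSet, ae_restrict_of_ae
      (ae_tendsto_mollify rOut_tendsto rOut_le_rIn hu.locallyIntegrable)] with x hxS hx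
    simpa only [indicator_of_mem (hST hxS)] using hx
  · refine tendsto_const_nhds.squeeze
      (tendsto_lintegral_enorm_mollify_sub rOut_tendsto rOut_le_rIn hu) (fun _ => zero_le)
      fun k => (setLIntegral_congr_fun hS.measurableSet fun x hx => ?_).trans_le
        (setLIntegral_le_lintegral S _)
    rw [indicator_of_mem (hST hx)]
  · refine tendsto_const_nhds.squeeze
      (tendsto_lintegral_enorm_mollify_sub rOut_tendsto rOut_le_rIn hv) (fun _ => zero_le)
      fun k => (setLIntegral_congr_fun hS.measurableSet fun x hx => ?_).trans_le
        (setLIntegral_le_lintegral S _)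
    have closedBall_subset : Metric.closedBall x (η k).rOut ⊆ T :=
      (Metric.closedBall_subset_closedBall (rOut_le k)).trans
        (Metric.closedBall_subset_cthickening hx δ)
    rw [h.fderiv_mollify_indicator hT hTΩ closedBall_subset, indicator_of_mem (hST hx)]

end HasWeakDerivOn

end SmoothApproximation

section ChainRules

namespace HasWeakDerivOn

variable {n : ℕ} {F : Type*} [NormedAddCommGroup F] [NormedSpace ℝ F]
  {u : RSpace n → F} {v : RSpace n → RSpace n →L[ℝ] F}

theorem comp_left [CompleteSpace F] {G : Type*} [NormedAddCommGroup G] [NormedSpace ℝ G]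
    [FiniteDimensional ℝ G] {Ω : Set (RSpace n)} (hΩ : IsOpen Ω) (h : HasWeakDerivOn Ω u v)
    {Φ : F → G} (hΦ : ContDiff ℝ 1 Φ) {M : ℝ≥0} (hM : LipschitzWith M Φ) :
    HasWeakDerivOn Ω (fun x => Φ (u x)) (fun x => (fderiv ℝ Φ (u x)).comp (v x)) := by
  have continuous_fderiv_Φ : Continuous (fderiv ℝ Φ) := hΦ.continuous_fderiv one_ne_zero
  have enorm_fderiv_Φ_le (z : F) : ‖fderiv ℝ Φ z‖ₑ ≤ M :=
    enorm_le_coe.2 (norm_fderiv_le_of_lipschitz ℝ hM)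
  have measurable_u := h.locallyIntegrableOn.aestronglyMeasurable
  have measurable_v := h.locallyIntegrableOn_deriv.aestronglyMeasurable
  refine of_forall_isCompact_tendsto hΩ (hΦ.continuous.comp_aestronglyMeasurable measurable_u)
    ((ContinuousLinearMap.compL ℝ _ F G).aestronglyMeasurable_comp₂
      (continuous_fderiv_Φ.comp_aestronglyMeasurable measurable_u) measurable_v)
    fun S hSΩ hS => ?_
  obtain ⟨a, ha, hac, ha_ae, ha_lim, hda_lim⟩ := h.exists_contDiff_tendsto hΩ hS hSΩ
  have fderiv_comp (k : ℕ) (x : RSpace n) : fderiv ℝ (fun x => Φ (a k x)) x =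
      (fderiv ℝ Φ (a k x)).comp (fderiv ℝ (a k) x) :=
    fderiv_fun_comp x (hΦ.differentiable one_ne_zero _) ((ha k).differentiable one_ne_zero x)
  refine ⟨fun k x => Φ (a k x), fun k => fderiv ℝ fun x => Φ (a k x), fun k => ?_, ?_, ?_⟩
  · obtain ⟨C, hC⟩ := (ha k).lipschitzWith_of_hasCompactSupport (hac k) one_ne_zero
    exact of_lipschitzOnWith hΩ (hM.comp hC).lipschitzOnWith
  · refine tendsto_const_nhds.squeeze
      (by simpa using ENNReal.Tendsto.const_mul ha_lim (Or.inr (ENNReal.coe_ne_top (r := M))))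
      (fun _ => zero_le) fun k => ?_
    rw [← lintegral_const_mul' _ _ ENNReal.coe_ne_top]
    refine lintegral_mono fun x => ?_
    simpa only [edist_eq_enorm_sub] using hM (a k x) (u x)
  · simp only [fderiv_comp]
    exact tendsto_lintegral_enorm_clm_comp_sub (M := M)
      (fun k => (continuous_fderiv_Φ.comp (ha k).continuous).aestronglyMeasurable)
      ((continuous_fderiv_Φ.comp_aestronglyMeasurable measurable_u).mono_set hSΩ)
      (fun k x => enorm_fderiv_Φ_le _) (fun x => enorm_fderiv_Φ_le _)
      (ha_ae.mono fun x hx => (continuous_fderiv_Φ.tendsto _).comp hx)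
      (h.locallyIntegrableOn_deriv.integrableOn_compact_subset hSΩ hS) hda_lim

variable [FiniteDimensional ℝ F] {e : OpenPartialHomeomorph (RSpace n) (RSpace n)} {K K' : ℝ≥0}

theorem of_contDiff_comp_symm {a : RSpace n → F} (ha : ContDiff ℝ 1 a) (hc : HasCompactSupport a)
    (he' : LipschitzOnWith K' e.symm e.target) :
    HasWeakDerivOn e.target (fun y => a (e.symm y))
      (fun y => (fderiv ℝ a (e.symm y)).comp (fderiv ℝ e.symm y)) := by
  obtain ⟨C, hC⟩ := ha.lipschitzWith_of_hasCompactSupport hc one_ne_zero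
  refine (of_lipschitzOnWith e.open_target (hC.comp_lipschitzOnWith he')).congr .rfl ?_
  filter_upwards [ae_restrict_mem e.open_target.measurableSet,
    ae_restrict_of_ae he'.ae_differentiableWithinAt_of_mem] with y hy hdiff
  exact fderiv_fun_comp y (ha.differentiable one_ne_zero _)
    ((hdiff hy).differentiableAt (e.open_target.mem_nhds hy))

theorem comp_symm (h : HasWeakDerivOn e.source u v) (he : LipschitzOnWith K e e.source)
    (he' : LipschitzOnWith K' e.symm e.target) :
    HasWeakDerivOn e.target (fun y => u (e.symm y))
      (fun y => (v (e.symm y)).comp (fderiv ℝ e.symm y)) := by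
  have := FiniteDimensional.complete ℝ F
  have measurable_symm : AEMeasurable e.symm (volume.restrict e.target) :=
    aemeasurable_symm_restrict e subset_rfl
  have map_target_le := map_symm_restrict_target_le_of_lipschitzOnWith (μ := volume) he
  refine of_forall_isCompact_tendsto e.open_target
    (aestronglyMeasurable_comp_of_map_le_smul measurable_symm map_target_le
      h.locallyIntegrableOn.aestronglyMeasurable)
    ((ContinuousLinearMap.compL ℝ _ _ F).aestronglyMeasurable_comp₂
      (aestronglyMeasurable_comp_of_map_le_smul measurable_symm map_target_le
        h.locallyIntegrableOn_deriv.aestronglyMeasurable)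
      (measurable_fderiv ℝ e.symm).aestronglyMeasurable) fun S hSe hS => ?_
  have image_subset : e.symm '' S ⊆ e.source := image_subset_iff.2 fun y hy => e.map_target (hSe hy)
  obtain ⟨a, ha, hac, -, ha_lim, hda_lim⟩ := h.exists_contDiff_tendsto e.open_source
    (hS.image_of_continuousOn (e.continuousOn_symm.mono hSe)) image_subset
  have map_le := map_symm_restrict_le_of_lipschitzOnWith (μ := volume) he hS.measurableSet hSe
  have measurable_symm_S := aemeasurable_symm_restrict (μ := volume) e hSe
  refine ⟨_, _, fun k => of_contDiff_comp_symm (ha k) (hac k) he', ?_, ?_⟩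
  · exact tendsto_lintegral_enorm_comp_sub_of_map_le_smul measurable_symm_S map_le
      (fun k => (ha k).continuous.aestronglyMeasurable)
      (h.locallyIntegrableOn.aestronglyMeasurable.mono_set image_subset) ha_lim
  · have fderiv_lim := tendsto_lintegral_enorm_comp_sub_of_map_le_smul measurable_symm_S map_le
      (fun k => ((ha k).continuous_fderiv one_ne_zero).aestronglyMeasurable)
      (h.locallyIntegrableOn_deriv.aestronglyMeasurable.mono_set image_subset) hda_lim
    refine tendsto_const_nhds.squeeze
      (by simpa using ENNReal.Tendsto.const_mul fderiv_lim (Or.inr (ENNReal.coe_ne_top (r := K'))))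
      (fun _ => zero_le) fun k => ?_
    rw [← lintegral_const_mul' _ _ ENNReal.coe_ne_top]
    refine setLIntegral_mono' hS.measurableSet fun y hy => ?_
    have enorm_fderiv_symm_le : ‖fderiv ℝ e.symm y‖ₑ ≤ K' := enorm_le_coe.2
      (norm_fderiv_le_of_lipschitzOn ℝ (e.open_target.mem_nhds (hSe hy)) he')
    rw [← ContinuousLinearMap.sub_comp, mul_comm]
    exact (ContinuousLinearMap.opENorm_comp_le _ _).trans (mul_le_mul_right enorm_fderiv_symm_le _)

end HasWeakDerivOn

end ChainRules

section Rearrangement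

variable {α : Type*} [MeasurableSpace α] {μ : Measure α} {f : α → ℝ≥0∞}

theorem antitone_rearrangement (μ : Measure α) (f : α → ℝ≥0∞) : Antitone (rearrangement μ f) :=
  fun _ _ hst => sInf_le_sInf fun _ hc => hc.trans (ENNReal.ofReal_le_ofReal hst)

theorem lt_rearrangement_iff {c : ℝ≥0∞} {s : ℝ} :
    c < rearrangement μ f s ↔ ENNReal.ofReal s < μ {x | c < f x} := by
  refine ⟨fun hc => lt_of_not_ge fun hle => hc.not_ge (sInf_le hle), fun hs => ?_⟩
  obtain ⟨d, hd_anti, hcd, hd_lim⟩ : ∃ d : ℕ → ℝ≥0∞, StrictAnti d ∧ (∀ k, c < d k) ∧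
      Tendsto d atTop (𝓝 c) := by
    refine exists_seq_strictAnti_tendsto' (y := ⊤) (lt_top_iff_ne_top.2 ?_) |>.imp
      fun d hd => ⟨hd.1, fun k => (hd.2.1 k).1, hd.2.2⟩
    rintro rfl
    simp at hs
  have superlevel_eq : {x | c < f x} = ⋃ k, {x | d k < f x} := by
    ext x
    simp only [mem_ofPred_eq, mem_iUnion]
    exact ⟨fun hx => (hd_lim.eventually_lt_const hx).exists, fun ⟨k, hk⟩ => (hcd k).trans hk⟩
  have measure_tendsto : Tendsto (fun k => μ {x | d k < f x}) atTop (𝓝 (μ {x | c < f x})) :=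
    superlevel_eq ▸ tendsto_measure_iUnion_atTop
      fun i j hij x hx => (hd_anti.antitone hij).trans_lt hx
  obtain ⟨k, hk⟩ := (measure_tendsto.eventually_const_lt hs).exists
  refine (hcd k).trans_le (le_sInf fun b hb => le_of_lt (lt_of_not_ge fun hbd => hk.not_ge ?_))
  exact (measure_mono fun x hx => lt_of_le_of_lt hbd hx).trans hb

end Rearrangement

theorem volume_Ioo_inter_preimage_div_two (S : Set ℝ) :
    volume (Ioo (0 : ℝ) 1 ∩ (· / 2) ⁻¹' S) = 2 * volume (Ioo (0 : ℝ) (1 / 2) ∩ S) := by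
  have preimage_eq : Ioo (0 : ℝ) 1 ∩ (· / 2) ⁻¹' S = (· * 2⁻¹) ⁻¹' (Ioo (0 : ℝ) (1 / 2) ∩ S) := by
    ext s
    simp only [mem_inter_iff, mem_Ioo, mem_preimage, div_eq_mul_inv]
    constructor <;> rintro ⟨⟨h₀, h₁⟩, hs⟩ <;> refine ⟨⟨?_, ?_⟩, hs⟩ <;> linarith
  rw [preimage_eq, Real.volume_preimage_mul_right (by norm_num)]
  norm_num

theorem volume_Ioo_inter_setOf_lt_indicator_add_indicator_sub {h : ℝ → ℝ≥0∞} (hh : Measurable h)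
    (c : ℝ≥0∞) :
    volume (Ioo (0 : ℝ) 1 ∩ {s | c < (Ioo (0 : ℝ) (1 / 2)).indicator h s +
      (Ioo (0 : ℝ) (1 / 2)).indicator h (s - 1 / 2)}) =
    2 * volume (Ioo (0 : ℝ) (1 / 2) ∩ {s | c < h s}) := by
  set A : Set ℝ := Ioo (0 : ℝ) (1 / 2) ∩ {s | c < h s}
  have hA : MeasurableSet A := measurableSet_Ioo.inter (measurableSet_lt measurable_const hh)
  have superlevel_eq : Ioo (0 : ℝ) 1 ∩ {s | c < (Ioo (0 : ℝ) (1 / 2)).indicator h s +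
      (Ioo (0 : ℝ) (1 / 2)).indicator h (s - 1 / 2)} = A ∪ (· - 1 / 2) ⁻¹' A := by
    ext s
    simp only [A, mem_inter_iff, mem_union, mem_preimage, mem_ofPred_eq, indicator_apply, mem_Ioo]
    by_cases hleft : 0 < s ∧ s < 1 / 2
    · have hright : ¬(0 < s - 1 / 2 ∧ s - 1 / 2 < 1 / 2) := fun hs => by linarith [hs.1, hleft.2]
      simp only [hleft, hright, and_self, if_true, if_false, add_zero, true_and, false_and,
        or_false, and_iff_right_iff_imp]
      exact fun _ => by linarith [hleft.2]
    · by_cases hright : 0 < s - 1 / 2 ∧ s - 1 / 2 < 1 / 2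
      · simp only [hleft, hright, and_self, if_true, if_false, zero_add, true_and, false_and,
          false_or, and_iff_right_iff_imp]
        exact fun _ => ⟨by linarith [hright.1], by linarith [hright.2]⟩
      · simp only [hleft, hright, if_false, add_zero, not_lt_zero, false_and, and_false, or_self]
  have hdisj : Disjoint A ((· - 1 / 2) ⁻¹' A) :=
    disjoint_left.2 fun s hs hs' => by linarith [hs.1.2, hs'.1.1]
  rw [superlevel_eq, measure_union hdisj (hA.preimage (measurable_id.sub_const _)),
    (measurePreserving_sub_right volume (1 / 2)).measure_preimage hA.nullMeasurableSet, two_mul]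

namespace IsRIBanachFunctionNorm

theorem comp_measurePreserving {α β : Type*} [MeasurableSpace α] [MeasurableSpace β]
    {μ : Measure α} {ν : Measure β} {ρ : (α → ℝ≥0∞) → ℝ≥0∞} (hρ : IsRIBanachFunctionNorm μ ρ)
    {φ : α → β} (hφ : MeasurePreserving φ μ ν) :
    IsRIBanachFunctionNorm ν fun h => ρ fun x => h (φ x) := by
  have measurable_comp {h : β → ℝ≥0∞} (hh : AEMeasurable h ν) : AEMeasurable (fun x => h (φ x)) μ :=
    hh.comp_quasiMeasurePreserving hφ.quasiMeasurePreserving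
  have lintegral_comp {h : β → ℝ≥0∞} (hh : AEMeasurable h ν) {s : Set β} (hs : MeasurableSet s) :
      ∫⁻ x in φ ⁻¹' s, h (φ x) ∂μ = ∫⁻ y in s, h y ∂ν := by
    have hφs := hφ.restrict_preimage hs
    rw [← hφs.map_eq, lintegral_map' (by rw [hφs.map_eq]; exact hh.restrict) hφs.aemeasurable]
  have measure_comp {h : β → ℝ≥0∞} (hh : AEMeasurable h ν) (c : ℝ≥0) :
      μ {x | (c : ℝ≥0∞) < h (φ x)} = ν {y | (c : ℝ≥0∞) < h y} :=
    hφ.measure_preimage (nullMeasurableSet_lt aemeasurable_const hh)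
  constructor
  · constructor
    · intro h hh
      rw [hρ.eq_zero_iff _ (measurable_comp hh), ← lintegral_eq_zero_iff' hh,
        ← lintegral_eq_zero_iff' (measurable_comp hh)]
      simpa using congrArg (· = 0) (lintegral_comp hh MeasurableSet.univ)
    · exact fun a h hh => hρ.smul a _ (measurable_comp hh)
    · exact fun h k hh hk => hρ.add_le _ _ (measurable_comp hh) (measurable_comp hk)
    · exact fun h k hh hk hle => hρ.mono _ _ (measurable_comp hh) (measurable_comp hk)
        (hφ.quasiMeasurePreserving.ae hle)
    · exact fun h k hh hk hmono hlim => hρ.fatou _ _ (fun i => measurable_comp (hh i))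
        (measurable_comp hk) (hφ.quasiMeasurePreserving.ae hmono)
        (hφ.quasiMeasurePreserving.ae hlim)
    · exact fun s hs hνs => hρ.indicator_lt_top (φ ⁻¹' s) (hφ.measurable hs)
        (by rwa [hφ.measure_preimage hs.nullMeasurableSet])
    · intro s hs hνs
      obtain ⟨C, hC⟩ := hρ.lintegral_le (φ ⁻¹' s) (hφ.measurable hs)
        (by rwa [hφ.measure_preimage hs.nullMeasurableSet])
      exact ⟨C, fun h hh => (lintegral_comp hh hs).ge.trans (hC _ (measurable_comp hh))⟩
  · exact fun h k hh hk heq => hρ.rearrangement_invariant _ _ (measurable_comp hh)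
      (measurable_comp hk) fun c => by rw [measure_comp hh, measure_comp hk, heq]

variable {ρ : (ℝ → ℝ≥0∞) → ℝ≥0∞} {h : ℝ → ℝ≥0∞}

theorem comp_half_le (hρ : IsRIBanachFunctionNorm (volume.restrict (Ioo (0 : ℝ) 1)) ρ)
    (hh : Measurable h) : ρ (fun s => h (s / 2)) ≤ 2 * ρ h := by
  set h₀ : ℝ → ℝ≥0∞ := (Ioo (0 : ℝ) (1 / 2)).indicator h
  have hh₀ : Measurable h₀ := hh.indicator measurableSet_Ioo
  have hh₁ : Measurable fun s => h₀ (s - 1 / 2) := hh₀.comp (measurable_id.sub_const _)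
  have hh₂ : Measurable fun s => h (s / 2) := hh.comp (measurable_id.div_const _)
  have norm_translate : ρ (fun s => h₀ (s - 1 / 2)) = ρ h₀ := by
    refine hρ.rearrangement_invariant _ _ hh₁.aemeasurable hh₀.aemeasurable fun c => ?_
    rw [Measure.restrict_eq_self _ fun s hs => ?_, Measure.restrict_eq_self _ fun s hs => ?_]
    · exact (measurePreserving_sub_right volume (1 / 2)).measure_preimage
        (measurableSet_lt measurable_const hh₀).nullMeasurableSet
    · have hs' := mem_of_indicator_ne_zero (ne_zero_of_lt (mem_ofPred.1 hs))
      exact ⟨hs'.1, by linarith [hs'.2]⟩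
    · have hs' := mem_of_indicator_ne_zero (ne_zero_of_lt (mem_ofPred.1 hs))
      exact ⟨by linarith [hs'.1], by linarith [hs'.2]⟩
  calc ρ (fun s => h (s / 2)) = ρ (fun s => h₀ s + h₀ (s - 1 / 2)) := by
        refine hρ.rearrangement_invariant _ _ hh₂.aemeasurable
          (hh₀.add hh₁).aemeasurable fun c => ?_
        rw [Measure.restrict_apply' measurableSet_Ioo, Measure.restrict_apply' measurableSet_Ioo,
          inter_comm _ (Ioo 0 1), inter_comm _ (Ioo 0 1),
          volume_Ioo_inter_setOf_lt_indicator_add_indicator_sub hh]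
        exact volume_Ioo_inter_preimage_div_two {s | (c : ℝ≥0∞) < h s}
    _ ≤ ρ h₀ + ρ (fun s => h₀ (s - 1 / 2)) := hρ.add_le _ _ hh₀.aemeasurable hh₁.aemeasurable
    _ = 2 * ρ h₀ := by rw [norm_translate, two_mul]
    _ ≤ 2 * ρ h := by
        gcongr
        exact hρ.mono _ _ hh₀.aemeasurable hh.aemeasurable
          (Eventually.of_forall fun s => indicator_le_self _ h s)

theorem comp_div_two_pow_le (hρ : IsRIBanachFunctionNorm (volume.restrict (Ioo (0 : ℝ) 1)) ρ)
    (hh : Measurable h) (p : ℕ) : ρ (fun s => h (s / 2 ^ p)) ≤ 2 ^ p * ρ h := by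
  induction p with
  | zero => simp
  | succ p ih =>
    calc ρ (fun s => h (s / 2 ^ (p + 1))) = ρ (fun s => h (s / 2 / 2 ^ p)) := by
          simp only [pow_succ', div_div]
      _ ≤ 2 * ρ (fun s => h (s / 2 ^ p)) :=
          hρ.comp_half_le (h := fun s => h (s / 2 ^ p)) (hh.comp (measurable_id.div_const _))
      _ ≤ 2 * (2 ^ p * ρ h) := by gcongr
      _ = 2 ^ (p + 1) * ρ h := by rw [pow_succ', mul_assoc]

end IsRIBanachFunctionNorm

section UnitCube

variable {n : ℕ}

/-- The open unit cube of `ℝⁿ`, the domain of measure one through which an r.i. space on `ℝⁿ` is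
represented on the interval `(0, 1)`. -/
def unitCube (n : ℕ) : Set (RSpace n) :=
  {x | ∀ i, x i ∈ Ioo (0 : ℝ) 1}

instance isProbabilityMeasure_restrict_Ioo_zero_one :
    IsProbabilityMeasure (volume.restrict (Ioo (0 : ℝ) 1)) :=
  ⟨by simp⟩

theorem measurePreserving_ofLp_unitCube :
    MeasurePreserving (WithLp.ofLp : RSpace n → Fin n → ℝ) (volume.restrict (unitCube n))
      (Measure.pi fun _ => volume.restrict (Ioo (0 : ℝ) 1)) := by
  have unitCube_eq : unitCube n = WithLp.ofLp ⁻¹' univ.pi fun _ => Ioo (0 : ℝ) 1 := by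
    ext x
    simp [unitCube]
  rw [unitCube_eq, ← Measure.restrict_pi_pi]
  exact (PiLp.volume_preserving_ofLp (Fin n)).restrict_preimage
    (MeasurableSet.univ_pi fun _ => measurableSet_Ioo)

theorem measurePreserving_eval_unitCube (i : Fin n) :
    MeasurePreserving (fun x : RSpace n => x i) (volume.restrict (unitCube n))
      (volume.restrict (Ioo (0 : ℝ) 1)) :=
  (measurePreserving_eval (fun _ => volume.restrict (Ioo (0 : ℝ) 1)) i).comp
    measurePreserving_ofLp_unitCube

theorem volume_unitCube : volume (unitCube n) = 1 := by
  simpa using measurePreserving_ofLp_unitCube.measure_preimage (nullMeasurableSet_univ (μ := _))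

theorem isFiniteDomain_unitCube : IsFiniteDomain (unitCube n) where
  isOpen := by
    simp only [unitCube, Set.ofPred_forall]
    exact isOpen_iInter_of_finite fun i => isOpen_Ioo.preimage (by fun_prop)
  nonempty := nonempty_of_measure_ne_zero (volume_unitCube ▸ one_ne_zero)
  volume_lt_top := volume_unitCube ▸ ENNReal.one_lt_top

end UnitCube

section Representation

theorem rearrangement_comp_measurePreserving {α β : Type*} [MeasurableSpace α]
    [MeasurableSpace β] {μ : Measure α} {ν : Measure β} {φ : α → β} (hφ : MeasurePreserving φ μ ν)
    {h : β → ℝ≥0∞} (hh : Measurable h) :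
    rearrangement μ (fun x => h (φ x)) = rearrangement ν h := by
  ext s
  have measure_comp (c : ℝ≥0∞) : μ {x | c < h (φ x)} = ν {y | c < h y} :=
    hφ.measure_preimage (measurableSet_lt measurable_const hh).nullMeasurableSet
  simp only [rearrangement, measure_comp]

theorem rearrangement_rearrangement_mul {α : Type*} [MeasurableSpace α] {μ : Measure α}
    [IsFiniteMeasure μ] [NeZero μ] (f : α → ℝ≥0∞) {s : ℝ} (hs : 0 ≤ s) :
    rearrangement (volume.restrict (Ioo (0 : ℝ) 1))
      (fun t => rearrangement μ f (μ.real univ * t)) s = rearrangement μ f (μ.real univ * s) := by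
  have hμ : 0 < μ.real univ := measureReal_univ_pos
  refine eq_of_forall_lt_iff fun c => ?_
  set m := μ.real {x | c < f x}
  have ofReal_mul_lt_iff {t : ℝ} (ht : 0 ≤ t) :
      ENNReal.ofReal (μ.real univ * t) < μ {x | c < f x} ↔ t < m / μ.real univ := by
    rw [ENNReal.ofReal_lt_iff_lt_toReal (by positivity) (measure_ne_top μ _), lt_div_iff₀' hμ]
    rfl
  have hm : m / μ.real univ ≤ 1 := div_le_one_of_le₀ (measureReal_mono (subset_univ _)) hμ.le
  have superlevel_eq : {t | c < rearrangement μ f (μ.real univ * t)} ∩ Ioo 0 1 =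
      Ioo 0 (m / μ.real univ) := by
    ext t
    simp only [mem_inter_iff, mem_ofPred_eq, lt_rearrangement_iff, mem_Ioo]
    exact ⟨fun ⟨hc, ht, _⟩ => ⟨ht, (ofReal_mul_lt_iff ht.le).1 hc⟩,
      fun ⟨ht, hc⟩ => ⟨(ofReal_mul_lt_iff ht.le).2 hc, ht, hc.trans_le hm⟩⟩
  rw [lt_rearrangement_iff, lt_rearrangement_iff, Measure.restrict_apply' measurableSet_Ioo,
    superlevel_eq, Real.volume_Ioo, sub_zero, ofReal_mul_lt_iff hs,
    ENNReal.ofReal_lt_ofReal_iff_of_nonneg hs]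

theorem rearrangement_le_rearrangement {α β : Type*} [MeasurableSpace α] [MeasurableSpace β]
    {μ : Measure α} {ν : Measure β} {f : α → ℝ≥0∞} {g : β → ℝ≥0∞} {c : ℝ≥0∞}
    (hfg : ∀ v, ν {y | v < g y} ≤ c * μ {x | v < f x}) {s t : ℝ}
    (hst : c * ENNReal.ofReal s ≤ ENNReal.ofReal t) :
    rearrangement ν g t ≤ rearrangement μ f s :=
  sInf_le_sInf fun v hv => (hfg v).trans ((mul_le_mul_right hv c).trans hst)

end Representation

namespace IsFiniteDomain

variable {n : ℕ} {G : Set (RSpace n)}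

theorem of_isCompact_closure (hG : IsOpen G) (hne : G.Nonempty) (hc : IsCompact (closure G)) :
    IsFiniteDomain G :=
  ⟨hG, hne, (measure_mono subset_closure).trans_lt hc.measure_lt_top⟩

theorem volume_ne_zero (hG : IsFiniteDomain G) : volume G ≠ 0 :=
  (hG.isOpen.measure_pos volume hG.nonempty).ne'

theorem volumeReal_pos (hG : IsFiniteDomain G) : 0 < volume.real G :=
  ENNReal.toReal_pos hG.volume_ne_zero hG.volume_lt_top.ne

end IsFiniteDomain

namespace RIBanachFunctionSpace

section RepresentationNorm

variable {n : ℕ} [NeZero n]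

/-- The norm representing an r.i. Banach function space by functions on the interval `(0, 1)`
(Luxemburg representation): a function of one variable is evaluated as a function on the unit cube
which depends on the first coordinate only. -/
noncomputable def representationNorm (X : RIBanachFunctionSpace n) (h : ℝ → ℝ≥0∞) : ℝ≥0∞ :=
  X.norm (unitCube n) fun x => h (x 0)

theorem isRI_representationNorm (X : RIBanachFunctionSpace n) :
    IsRIBanachFunctionNorm (volume.restrict (Ioo (0 : ℝ) 1)) X.representationNorm :=
  (X.isRI _ isFiniteDomain_unitCube).comp_measurePreserving (measurePreserving_eval_unitCube 0)

theorem norm_eq_mul_representationNorm (X : RIBanachFunctionSpace n) {G : Set (RSpace n)}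
    (hG : IsFiniteDomain G) {f : RSpace n → ℝ≥0∞} (hf : AEMeasurable f (volume.restrict G)) :
    X.norm G f = volume G * X.representationNorm fun s =>
      rearrangement (volume.restrict G) f (volume.real G * s) := by
  have : IsFiniteMeasure (volume.restrict G) := ⟨by simpa using hG.volume_lt_top⟩
  have : NeZero (volume.restrict G) := ⟨by simpa using hG.volume_ne_zero⟩
  set h : ℝ → ℝ≥0∞ := fun s => rearrangement (volume.restrict G) f (volume.real G * s)
  have hh : Measurable h := (antitone_rearrangement _ f).measurable.comp (measurable_const_mul _)
  have hcube : volume.real (unitCube n) = 1 := by simp [measureReal_def, volume_unitCube]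
  have rearrangement_eq : ∀ x ∈ Ioo 0 (volume.real G),
      dilation (volume.real (unitCube n)) (volume.real (unitCube n) / volume.real G)
        (rearrangement (volume.restrict (unitCube n)) fun y => h (y 0)) x =
      rearrangement (volume.restrict G) f x := by
    intro x hx
    have hxG : 1 / volume.real G * x = x / volume.real G := by ring
    rw [dilation, hcube, hxG, if_pos ((div_lt_one hG.volumeReal_pos).2 hx.2),
      rearrangement_comp_measurePreserving (measurePreserving_eval_unitCube 0) hh]
    simpa [h, mul_div_cancel₀ x hG.volumeReal_pos.ne'] using
      rearrangement_rearrangement_mul (μ := volume.restrict G) f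
        (div_nonneg hx.1.le hG.volumeReal_pos.le)
  have hsimilar := X.similar G (unitCube n) hG isFiniteDomain_unitCube f (fun y => h (y 0)) hf
    (hh.comp (measurePreserving_eval_unitCube 0).measurable).aemeasurable rearrangement_eq
  rw [representationNorm, ← hsimilar, volume_unitCube, one_div,
    ENNReal.mul_inv_cancel_left hG.volume_ne_zero hG.volume_lt_top.ne]

theorem norm_lt_top_of_measure_lt_le_of_neZero (X : RIBanachFunctionSpace n)
    {G G' : Set (RSpace n)} (hG : IsFiniteDomain G) (hG' : IsFiniteDomain G')
    {f g : RSpace n → ℝ≥0∞} (hf : AEMeasurable f (volume.restrict G))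
    (hg : AEMeasurable g (volume.restrict G'))
    {c : ℝ≥0} (hfg : ∀ v, volume.restrict G' {y | v < g y} ≤ c * volume.restrict G {x | v < f x})
    (hfin : X.norm G f < ⊤) : X.norm G' g < ⊤ := by
  obtain ⟨p, hp⟩ : ∃ p : ℕ, c * volume.real G / volume.real G' < 2 ^ p :=
    pow_unbounded_of_one_lt _ one_lt_two
  rw [div_lt_iff₀ hG'.volumeReal_pos] at hp
  set h : ℝ → ℝ≥0∞ := fun s => rearrangement (volume.restrict G) f (volume.real G * s)
  have hh : Measurable h := (antitone_rearrangement _ f).measurable.comp (measurable_const_mul _)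
  rw [X.norm_eq_mul_representationNorm hG hf] at hfin
  have hh_fin : X.representationNorm h < ⊤ :=
    ENNReal.lt_top_of_mul_ne_top_right hfin.ne hG.volume_ne_zero
  have hle : ∀ᵐ s ∂(volume.restrict (Ioo (0 : ℝ) 1)),
      rearrangement (volume.restrict G') g (volume.real G' * s) ≤ h (s / 2 ^ p) := by
    filter_upwards [ae_restrict_mem measurableSet_Ioo] with s hs
    refine rearrangement_le_rearrangement hfg ?_
    rw [← ENNReal.ofReal_coe_nnreal, ← ENNReal.ofReal_mul c.coe_nonneg]
    refine ENNReal.ofReal_le_ofReal ?_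
    calc c * (volume.real G * (s / 2 ^ p)) = c * volume.real G * (s / 2 ^ p) := by ring
      _ ≤ 2 ^ p * volume.real G' * (s / 2 ^ p) := by
        gcongr
        exact div_nonneg hs.1.le (by positivity)
      _ = volume.real G' * s := by field_simp
  rw [X.norm_eq_mul_representationNorm hG' hg]
  refine ENNReal.mul_lt_top hG'.volume_lt_top ?_
  calc X.representationNorm (fun s => rearrangement (volume.restrict G') g (volume.real G' * s))
      ≤ X.representationNorm fun s => h (s / 2 ^ p) :=
        X.isRI_representationNorm.mono _ _
          ((antitone_rearrangement _ g).measurable.comp (measurable_const_mul _)).aemeasurable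
          (hh.comp (measurable_id.div_const _)).aemeasurable hle
    _ ≤ 2 ^ p * X.representationNorm h := X.isRI_representationNorm.comp_div_two_pow_le hh p
    _ < ⊤ := ENNReal.mul_lt_top (by finiteness) hh_fin

end RepresentationNorm

variable {n : ℕ} {X : RIBanachFunctionSpace n} {G G' : Set (RSpace n)}

theorem norm_lt_top_of_measure_lt_le (hG : IsFiniteDomain G) (hG' : IsFiniteDomain G')
    {f g : RSpace n → ℝ≥0∞} (hf : AEMeasurable f (volume.restrict G))
    (hg : AEMeasurable g (volume.restrict G')) {c : ℝ≥0}
    (hfg : ∀ v, volume.restrict G' {y | v < g y} ≤ c * volume.restrict G {x | v < f x})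
    (hfin : X.norm G f < ⊤) : X.norm G' g < ⊤ := by
  rcases n with _ | n
  · obtain rfl : G' = G := hG'.nonempty.eq_univ.trans hG.nonempty.eq_univ.symm
    refine ((X.isRI G' hG).mono g f hg hf (Eventually.of_forall fun x => ?_)).trans_lt hfin
    by_contra! hlt
    have superlevel_g : {y | f x < g y} = univ :=
      (show {y | f x < g y}.Nonempty from ⟨x, hlt⟩).eq_univ
    have superlevel_f : {y | f x < f y} = ∅ :=
      eq_empty_of_forall_notMem fun y hy => (hy.ne (congrArg f (Subsingleton.elim x y)))
    simpa [superlevel_g, superlevel_f, hG.volume_ne_zero] using hfg (f x)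
  · exact X.norm_lt_top_of_measure_lt_le_of_neZero hG hG' hf hg hfg hfin

namespace Mem

variable {F F' : Type*} [NormedAddCommGroup F] [NormedAddCommGroup F'] {v : RSpace n → F}
  {w : RSpace n → F'}

theorem of_ae_enorm_le (hG : IsFiniteDomain G) (hv : X.Mem G v)
    (hw : AEStronglyMeasurable w (volume.restrict G)) {C : ℝ≥0}
    (hle : ∀ᵐ x ∂(volume.restrict G), ‖w x‖ₑ ≤ C * ‖v x‖ₑ) : X.Mem G w := by
  refine ⟨hw, ((X.isRI G hG).mono _ _ hw.enorm (hv.1.enorm.const_mul _) hle).trans_lt ?_⟩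
  rw [(X.isRI G hG).smul C _ hv.1.enorm]
  exact ENNReal.mul_lt_top ENNReal.coe_lt_top hv.2

theorem congr {v' : RSpace n → F} (hG : IsFiniteDomain G) (hv : X.Mem G v)
    (h : v =ᵐ[volume.restrict G] v') : X.Mem G v' :=
  hv.of_ae_enorm_le hG (hv.1.congr h) (C := 1) <| h.mono fun x hx => by simp [hx]

theorem const (hG : IsFiniteDomain G) (a : F) : X.Mem G fun _ => a := by
  have mem_one : X.Mem G fun _ => (1 : ℝ) := ⟨aestronglyMeasurable_const, by
    simpa using (X.isRI G hG).indicator_lt_top univ MeasurableSet.univ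
      (by simpa using hG.volume_lt_top)⟩
  exact mem_one.of_ae_enorm_le hG aestronglyMeasurable_const (C := ‖a‖₊)
    (Eventually.of_forall fun _ => by simp [enorm_eq_nnnorm])

theorem comp_lipschitzWith (hG : IsFiniteDomain G) (hv : X.Mem G v) {Φ : F → F'} {M : ℝ≥0}
    (hM : LipschitzWith M Φ) : X.Mem G fun x => Φ (v x) := by
  have hΦv := hM.continuous.comp_aestronglyMeasurable hv.1
  have measurable_bound := hv.1.enorm.const_mul (M : ℝ≥0∞)
  refine ⟨hΦv, ?_⟩
  calc X.norm G (fun x => ‖Φ (v x)‖ₑ)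
      ≤ X.norm G (fun x => M * ‖v x‖ₑ + ‖Φ 0‖ₑ) := by
        refine (X.isRI G hG).mono _ _ hΦv.enorm (measurable_bound.add_const _)
          (Eventually.of_forall fun x => ?_)
        calc ‖Φ (v x)‖ₑ = ‖Φ (v x) - Φ 0 + Φ 0‖ₑ := by rw [sub_add_cancel]
          _ ≤ ‖Φ (v x) - Φ 0‖ₑ + ‖Φ 0‖ₑ := enorm_add_le _ _
          _ ≤ M * ‖v x‖ₑ + ‖Φ 0‖ₑ := by
            gcongr
            simpa only [edist_eq_enorm_sub, sub_zero] using hM (v x) 0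
    _ ≤ X.norm G (fun x => M * ‖v x‖ₑ) + X.norm G (fun _ => ‖Φ 0‖ₑ) :=
        (X.isRI G hG).add_le _ _ measurable_bound aemeasurable_const
    _ = M * X.norm G (fun x => ‖v x‖ₑ) + X.norm G (fun _ => ‖Φ 0‖ₑ) := by
        rw [(X.isRI G hG).smul M _ hv.1.enorm]
    _ < ⊤ := ENNReal.add_lt_top.2 ⟨ENNReal.mul_lt_top ENNReal.coe_lt_top hv.2,
        (const hG (Φ 0)).2⟩

theorem comp_of_map_le_smul (hG : IsFiniteDomain G) (hG' : IsFiniteDomain G') (hv : X.Mem G v)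
    {g : RSpace n → RSpace n} (hg : AEMeasurable g (volume.restrict G')) {c : ℝ≥0}
    (hmap : (volume.restrict G').map g ≤ c • volume.restrict G) :
    X.Mem G' fun y => v (g y) := by
  have hvg := aestronglyMeasurable_comp_of_map_le_smul hg hmap hv.1
  refine ⟨hvg, norm_lt_top_of_measure_lt_le hG hG' hv.1.enorm hvg.enorm (c := c) (fun t => ?_) hv.2⟩
  exact (Measure.le_map_apply hg {x | t < ‖v x‖ₑ}).trans (Measure.le_iff'.1 hmap _)

end Mem

end RIBanachFunctionSpace

section Inversion

theorem exists_contDiff_hasCompactSupport_eqOn {E F : Type*} [NormedAddCommGroup E]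
    [NormedSpace ℝ E] [FiniteDimensional ℝ E] [NormedAddCommGroup F] [NormedSpace ℝ F] {k : ℕ∞}
    {f : E → F} {K U : Set E} (hK : IsCompact K) (hU : IsOpen U) (hKU : K ⊆ U)
    (hf : ContDiffOn ℝ k f U) :
    ∃ g : E → F, ContDiff ℝ k g ∧ HasCompactSupport g ∧ EqOn g f K := by
  have := FiniteDimensional.proper ℝ E
  obtain ⟨K', hK', hKK', hK'U⟩ := exists_compact_between hK hU hKU
  obtain ⟨χ, hχ, -, support_χ, hχ_one⟩ := exists_contMDiff_support_eq_eq_one_iff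
    (modelWithCornersSelf ℝ E) (n := k) isOpen_interior hK.isClosed hKK'
  rw [contMDiff_iff_contDiff] at hχ
  have tsupport_χ : tsupport χ ⊆ K' := by
    rw [tsupport, support_χ]
    exact hK'.isClosed.closure_interior_subset
  have tsupport_smul : tsupport (fun x => χ x • f x) ⊆ K' :=
    (tsupport_smul_subset_left χ f).trans tsupport_χ
  refine ⟨fun x => χ x • f x, contDiff_iff_contDiffAt.2 fun x => ?_,
    hK'.of_isClosed_subset (isClosed_tsupport _) tsupport_smul, fun x hx => ?_⟩
  · by_cases hx : x ∈ tsupport fun x => χ x • f x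
    · exact hχ.contDiffAt.smul (hf.contDiffAt (hU.mem_nhds (hK'U (tsupport_smul hx))))
    · exact contDiffAt_const.congr_of_eventuallyEq (notMem_tsupport_iff_eventuallyEq.1 hx)
  · simp only [(hχ_one x).1 hx, one_smul]

theorem isCompact_setOf_norm_le_and_inverse_norm_le {R : Type*} [NormedRing R] [ProperSpace R]
    (L : ℝ) : IsCompact {a : R | ‖a‖ ≤ L ∧ ∃ b, ‖b‖ ≤ L ∧ a * b = 1 ∧ b * a = 1} := by
  have isCompact_pairs : IsCompact ((Metric.closedBall (0 : R) L ×ˢ Metric.closedBall (0 : R) L) ∩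
      {p | p.1 * p.2 = 1 ∧ p.2 * p.1 = 1}) :=
    ((isCompact_closedBall _ _).prod (isCompact_closedBall _ _)).inter_right
      ((isClosed_eq (by fun_prop) continuous_const).inter
        (isClosed_eq (by fun_prop) continuous_const))
  convert isCompact_pairs.image continuous_fst using 1
  ext a
  simp [and_assoc]

theorem exists_contDiff_hasCompactSupport_eq_inverse (R : Type*) [NormedRing R]
    [NormedAlgebra ℝ R] [FiniteDimensional ℝ R] (k : ℕ∞) (L : ℝ) :
    ∃ Φ : R → R, ContDiff ℝ k Φ ∧ HasCompactSupport Φ ∧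
      ∀ a b, ‖a‖ ≤ L → ‖b‖ ≤ L → a * b = 1 → Φ a = b := by
  have := FiniteDimensional.proper ℝ R
  have := FiniteDimensional.complete ℝ R
  have : IsNoetherianRing R := isNoetherian_of_tower ℝ inferInstance
  obtain ⟨Φ, hΦ, hΦc, hΦ_eq⟩ := exists_contDiff_hasCompactSupport_eqOn (k := k)
    (f := Ring.inverse) (isCompact_setOf_norm_le_and_inverse_norm_le (R := R) L) Units.isOpen
    (fun a ⟨_, b, _, hab, hba⟩ => ⟨⟨a, b, hab, hba⟩, rfl⟩)
    (by rintro _ ⟨u, rfl⟩; exact (contDiffAt_ringInverse ℝ u).contDiffWithinAt)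
  refine ⟨Φ, hΦ, hΦc, fun a b ha hb hab => ?_⟩
  have hba : b * a = 1 := mul_eq_one_comm.1 hab
  exact (hΦ_eq ⟨ha, b, hb, hab, hba⟩).trans (Ring.inverse_unit ⟨a, b, hab, hba⟩)

theorem fderiv_mul_fderiv_symm {E : Type*} [NormedAddCommGroup E] [NormedSpace ℝ E]
    {e : OpenPartialHomeomorph E E} {y : E} (hy : y ∈ e.target)
    (he : DifferentiableAt ℝ e (e.symm y)) (he' : DifferentiableAt ℝ e.symm y) :
    fderiv ℝ e (e.symm y) * fderiv ℝ e.symm y = 1 :=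
  ((he.hasFDerivAt.comp y he'.hasFDerivAt).congr_of_eventuallyEq
    (EventuallyEq.symm (e.eventually_right_inverse hy))).unique (hasFDerivAt_id y)

theorem ae_comp_fderiv_symm_eq_fderiv_symm {E : Type*} [NormedAddCommGroup E] [NormedSpace ℝ E]
    [FiniteDimensional ℝ E] [MeasurableSpace E] [BorelSpace E] {μ : Measure E}
    [μ.IsAddHaarMeasure] {e : OpenPartialHomeomorph E E} {K : ℝ≥0}
    (he : LipschitzOnWith K e e.source) (he' : LipschitzOnWith K e.symm e.target)
    {Φ : (E →L[ℝ] E) → E →L[ℝ] E}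
    (hΦ : ∀ A B : E →L[ℝ] E, ‖A‖ ≤ K → ‖B‖ ≤ K → A * B = 1 → Φ A = B)
    {De : E → E →L[ℝ] E} (hDe : De =ᵐ[μ.restrict e.source] fderiv ℝ e) :
    (fun y => Φ (De (e.symm y))) =ᵐ[μ.restrict e.target] fderiv ℝ e.symm := by
  have map_le := map_symm_restrict_target_le_of_lipschitzOnWith (μ := μ) he
  have measurable_symm := aemeasurable_symm_restrict (μ := μ) e subset_rfl
  filter_upwards [ae_comp_of_map_le_smul measurable_symm map_le hDe,
    ae_comp_of_map_le_smul measurable_symm map_le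
      (ae_restrict_of_ae he.ae_differentiableWithinAt_of_mem),
    ae_restrict_of_ae he'.ae_differentiableWithinAt_of_mem,
    ae_restrict_mem e.open_target.measurableSet] with y hDe_eq hdiff hdiff' hy
  have source_mem := e.open_source.mem_nhds (e.map_target hy)
  have target_mem := e.open_target.mem_nhds hy
  rw [hDe_eq]
  exact hΦ _ _ (norm_fderiv_le_of_lipschitzOn ℝ source_mem he)
    (norm_fderiv_le_of_lipschitzOn ℝ target_mem he')
    (fderiv_mul_fderiv_symm hy ((hdiff (e.map_target hy)).differentiableAt source_mem)
      ((hdiff' hy).differentiableAt target_mem))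

end Inversion

section SobolevChainRules

variable {n : ℕ} {X : RIBanachFunctionSpace n} {F F' : Type*} [NormedAddCommGroup F]
  [NormedSpace ℝ F] [NormedAddCommGroup F'] [NormedSpace ℝ F'] {u u' : RSpace n → F}

theorem MemW1.congr {G : Set (RSpace n)} (hG : IsFiniteDomain G) (hu : MemW1 X G u)
    (h : u =ᵐ[volume.restrict G] u') : MemW1 X G u' :=
  let ⟨v, huv, hu, hv⟩ := hu
  ⟨v, huv.congr h .rfl, hu.congr hG h, hv⟩

theorem MemW1.comp_left [CompleteSpace F] [FiniteDimensional ℝ F'] {G : Set (RSpace n)}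
    (hG : IsFiniteDomain G) (hu : MemW1 X G u) {Φ : F → F'} (hΦ : ContDiff ℝ 1 Φ) {M : ℝ≥0}
    (hM : LipschitzWith M Φ) : MemW1 X G fun x => Φ (u x) := by
  obtain ⟨v, huv, hu, hv⟩ := hu
  have weakDeriv_comp := huv.comp_left hG.isOpen hΦ hM
  refine ⟨_, weakDeriv_comp, hu.comp_lipschitzWith hG hM, ?_⟩
  refine hv.of_ae_enorm_le hG weakDeriv_comp.locallyIntegrableOn_deriv.aestronglyMeasurable
    (C := M) (Eventually.of_forall fun x => ?_)
  exact (ContinuousLinearMap.opENorm_comp_le _ _).trans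
    (mul_le_mul_left (enorm_le_coe.2 (norm_fderiv_le_of_lipschitz ℝ hM)) _)

theorem MemW1.comp_symm [FiniteDimensional ℝ F]
    {e : OpenPartialHomeomorph (RSpace n) (RSpace n)} {K K' : ℝ≥0}
    (he : LipschitzOnWith K e e.source) (he' : LipschitzOnWith K' e.symm e.target)
    (hs : IsFiniteDomain e.source) (ht : IsFiniteDomain e.target) (hu : MemW1 X e.source u) :
    MemW1 X e.target fun y => u (e.symm y) := by
  obtain ⟨v, huv, hu, hv⟩ := hu
  have map_le := map_symm_restrict_target_le_of_lipschitzOnWith (μ := volume) he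
  have measurable_symm := aemeasurable_symm_restrict (μ := volume) e subset_rfl
  have weakDeriv_comp := huv.comp_symm he he'
  refine ⟨_, weakDeriv_comp, hu.comp_of_map_le_smul hs ht measurable_symm map_le, ?_⟩
  refine (hv.comp_of_map_le_smul hs ht measurable_symm map_le).of_ae_enorm_le ht
    weakDeriv_comp.locallyIntegrableOn_deriv.aestronglyMeasurable (C := K') ?_
  filter_upwards [ae_restrict_mem e.open_target.measurableSet] with y hy
  rw [mul_comm]
  exact (ContinuousLinearMap.opENorm_comp_le _ _).trans (mul_le_mul_right
    (enorm_le_coe.2 (norm_fderiv_le_of_lipschitzOn ℝ (e.open_target.mem_nhds hy) he')) _)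

theorem MemW1Loc.congr {Ω : Set (RSpace n)} (hu : MemW1Loc X Ω u)
    (h : u =ᵐ[volume.restrict Ω] u') : MemW1Loc X Ω u' :=
  fun G hG hne hc hsub => (hu G hG hne hc hsub).congr (.of_isCompact_closure hG hne hc)
    (ae_restrict_of_ae_restrict_of_subset (subset_closure.trans hsub) h)

theorem MemW1Loc.comp_left [CompleteSpace F] [FiniteDimensional ℝ F'] {Ω : Set (RSpace n)}
    (hu : MemW1Loc X Ω u) {Φ : F → F'} (hΦ : ContDiff ℝ 1 Φ) {M : ℝ≥0} (hM : LipschitzWith M Φ) :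
    MemW1Loc X Ω fun x => Φ (u x) :=
  fun G hG hne hc hsub =>
    (hu G hG hne hc hsub).comp_left (.of_isCompact_closure hG hne hc) hΦ hM

theorem MemW1Loc.comp_symm [FiniteDimensional ℝ F]
    {e : OpenPartialHomeomorph (RSpace n) (RSpace n)} {K K' : ℝ≥0}
    (he : LipschitzOnWith K e e.source) (he' : LipschitzOnWith K' e.symm e.target)
    (hu : MemW1Loc X e.source u) :
    MemW1Loc X e.target fun y => u (e.symm y) := by
  intro G hG hne hc hsub
  have hGe : G ⊆ e.target := subset_closure.trans hsub
  set e' := (e.symm.restrOpen G hG).symm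
  have target_eq : e'.target = G := inter_eq_right.2 hGe
  have source_eq : e'.source = e.symm '' G := by
    rw [← target_eq]
    exact e'.symm_image_target_eq_source.symm
  have isCompact_image : IsCompact (e.symm '' closure G) :=
    hc.image_of_continuousOn (e.continuousOn_symm.mono hsub)
  have closure_source_subset : closure e'.source ⊆ e.symm '' closure G :=
    closure_minimal (source_eq ▸ image_mono subset_closure) isCompact_image.isClosed
  have image_subset : e.symm '' closure G ⊆ e.source :=
    image_subset_iff.2 fun y hy => e.map_target (hsub hy)
  have isCompact_closure_source : IsCompact (closure e'.source) :=
    isCompact_image.of_isClosed_subset isClosed_closure closure_source_subset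
  have source_nonempty : e'.source.Nonempty := source_eq ▸ hne.image _
  have memW1_source := hu e'.source e'.open_source source_nonempty isCompact_closure_source
    (closure_source_subset.trans image_subset)
  have memW1_target := memW1_source.comp_symm (e := e')
    (he.mono ((subset_closure.trans closure_source_subset).trans image_subset))
    (he'.mono (target_eq ▸ hGe))
    (.of_isCompact_closure e'.open_source source_nonempty isCompact_closure_source)
    (target_eq ▸ .of_isCompact_closure hG hne hc)
  rwa [target_eq] at memW1_target

theorem MemW1Loc.fderiv_symm {e : OpenPartialHomeomorph (RSpace n) (RSpace n)} {K : ℝ≥0}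
    (he : LipschitzOnWith K e e.source) (he' : LipschitzOnWith K e.symm e.target)
    {De : RSpace n → RSpace n →L[ℝ] RSpace n} (hDe : HasWeakDerivOn e.source e De)
    (hW : MemW1Loc X e.source De) : MemW1Loc X e.target (fderiv ℝ e.symm) := by
  obtain ⟨Φ, hΦ, hΦc, hΦ_inverse⟩ :=
    exists_contDiff_hasCompactSupport_eq_inverse (RSpace n →L[ℝ] RSpace n) 1 K
  obtain ⟨M, hM⟩ := ContDiff.lipschitzWith_of_hasCompactSupport hΦc hΦ one_ne_zero
  have hDe_ae : De =ᵐ[volume.restrict e.source] fderiv ℝ e :=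
    hDe.ae_eq e.open_source (.of_lipschitzOnWith e.open_source he)
  exact ((hW.comp_left hΦ hM).comp_symm he he').congr
    (ae_comp_fderiv_symm_eq_fderiv_symm he he' hΦ_inverse hDe_ae)

end SobolevChainRules

theorem IsBilipschitzOn.exists_lipschitzOnWith {n : ℕ}
    {e : OpenPartialHomeomorph (RSpace n) (RSpace n)} (he : IsBilipschitzOn e e.source) :
    ∃ K, LipschitzOnWith K e e.source ∧ LipschitzOnWith K e.symm e.target := by
  obtain ⟨L, hL, norm_bounds⟩ := he
  lift L to ℝ≥0 using hL.le
  refine ⟨L, .of_dist_le_mul fun x hx y hy => ?_, .of_dist_le_mul fun x hx y hy => ?_⟩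
  · simpa only [dist_eq_norm] using (norm_bounds x hx y hy).2
  · have lower_bound := (norm_bounds _ (e.map_target hx) _ (e.map_target hy)).1
    rw [e.right_inv hx, e.right_inv hy, inv_mul_le_iff₀ hL] at lower_bound
    simpa only [dist_eq_norm] using lower_bound

theorem mainTheorem6 (n : ℕ) (X : RIBanachFunctionSpace n) (Ω Ω' : Set (RSpace n))
    (hΩ : IsOpen Ω) (hΩ' : IsOpen Ω')
    (f : OpenPartialHomeomorph (RSpace n) (RSpace n))
    (hsource : f.source = Ω) (htarget : f.target = Ω')
    (hf : IsBilipschitzOn f Ω)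
    (Df : RSpace n → RSpace n →L[ℝ] RSpace n)
    (hDf : HasWeakDerivOn Ω f Df)
    (hW : MemW1Loc X Ω Df) :
    ∃ Dg : RSpace n → RSpace n →L[ℝ] RSpace n,
      HasWeakDerivOn Ω' f.symm Dg ∧ MemW1Loc X Ω' Dg := by
  subst hsource htarget
  obtain ⟨K, hfK, hfK'⟩ := hf.exists_lipschitzOnWith
  exact ⟨fderiv ℝ f.symm, .of_lipschitzOnWith hΩ' hfK', hW.fderiv_symm hfK hfK' hDf⟩
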